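/- Let $G$ be a linear algebraic group over $\mathbb{C}$ whose identity component $G^0$ is isomorphic, as an algebraic group, to $\operatorname{SL}_2(\mathbb{C})$ (so $G$ is reductive, possibly disconnected), and let $V$ be a finite-dimensional rational $G$-module. For a homogeneous $f\in\mathbb{C}[V]^G$ of degree $d$ and $k\ge 1$, the polarizations of $f$ are the functions $f_\alpha\in\mathbb{C}[kV]^G$ (where $kV$ is the direct sum of $k$ copies of $V$, $\alpha\in\mathbb{Z}_{\ge 0}^k$ and $|\alpha|=d$) defined by $$f\Big(\sum_{i=1}^k s_i v_i\Big)=\sum_{|\alpha|=d} s^\alpha f_\alpha(v_1,\dots,v_k).$$ Let $\operatorname{pol}_k(V)^G\subseteq\mathbb{C}[kV]^G$ be the subalgebra generated by the polarizations of all homogeneous elements of $\mathbb{C}[V]^G$; one says that $V$ has the $k$-polarization property if $\operatorname{pol}_k(V)^G=\mathbb{C}[kV]^G$. For $j\in\mathbb{N}$ let $R_j$ denote the irreducible $\operatorname{SL}_2$-module of dimension $j+1$. If $V$ contains a $G^0$-submodule isomorphic to $R_j$ for some odd $j$, then $V$ does not have the $2$-polarization property, i.e. $\operatorname{pol}_2(V)^G\neq\mathbb{C}[2V]^G$.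 -/

import Mathlib

open scoped MatrixGroups Topology

/-! ### Linear algebraic groups over `ℂ`

A linear algebraic group is a Zariski closed subgroup of `GL (Fin n) ℂ`. -/

/-- The common zero locus in `GL n ℂ` of a set of polynomials in the `n * n` matrix entries. -/
def glZeroLocus {n : ℕ} (S : Set (MvPolynomial (Fin n × Fin n) ℂ)) : Set (GL (Fin n) ℂ) :=
  {g | ∀ p ∈ S, MvPolynomial.eval (fun ij => (g : Matrix (Fin n) (Fin n) ℂ) ij.1 ij.2) p = 0}

/-- The Zariski topology on `GL n ℂ`: the closed sets are the zero loci of sets of polynomials in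
the matrix entries. It is not an instance, since Mathlib equips `GL n ℂ` with its classical
topology. -/
@[reducible] def zariskiTopology (n : ℕ) : TopologicalSpace (GL (Fin n) ℂ) :=
  TopologicalSpace.ofClosed {Z | ∃ S, Z = glZeroLocus S}
    ⟨{1}, by ext g; simp [glZeroLocus]⟩
    (by
      intro A hA
      refine ⟨{p | ∃ S, glZeroLocus S ∈ A ∧ p ∈ S}, ?_⟩
      ext g
      simp only [Set.mem_sInter, glZeroLocus, Set.mem_ofPred_eq]
      constructor
      · rintro h p ⟨S, hS, hp⟩
        exact h _ hS p hp
      · intro h Z hZ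
        obtain ⟨S, rfl⟩ := hA hZ
        intro p hp
        exact h p ⟨S, hZ, hp⟩)
    (by
      rintro _ ⟨S, rfl⟩ _ ⟨T, rfl⟩
      refine ⟨{r | ∃ p ∈ S, ∃ q ∈ T, r = p * q}, ?_⟩
      ext g
      simp only [Set.mem_union, glZeroLocus, Set.mem_ofPred_eq]
      constructor
      · rintro (h | h) r ⟨p, hp, q, hq, rfl⟩
        · simp [h p hp]
        · simp [h q hq]
      · intro h
        by_contra! hc
        obtain ⟨⟨p, hp, hp0⟩, q, hq, hq0⟩ := hc
        have := h _ ⟨p, hp, q, hq, rfl⟩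
        rw [map_mul] at this
        exact (mul_ne_zero hp0 hq0) this)

/-- A subgroup of `GL n ℂ` is a linear algebraic group if it is Zariski closed. -/
def IsLinearAlgebraicGroup {n : ℕ} (G : Subgroup (GL (Fin n) ℂ)) : Prop :=
  IsClosed[zariskiTopology n] (G : Set (GL (Fin n) ℂ))

/-- The algebra `ℂ[G]` of regular functions on a subgroup `G` of `GL n ℂ`: the functions that are
polynomials in the matrix entries and the inverse of the determinant. -/
def regularFunctions {n : ℕ} (G : Subgroup (GL (Fin n) ℂ)) : Subalgebra ℂ (G → ℂ) :=
  Algebra.adjoin ℂ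
    ({f | ∃ i k, f = fun g : G => ((g : GL (Fin n) ℂ) : Matrix (Fin n) (Fin n) ℂ) i k} ∪
      {fun g : G => (((g : GL (Fin n) ℂ) : Matrix (Fin n) (Fin n) ℂ).det)⁻¹})

/-- Two linear algebraic groups are isomorphic if there is a group isomorphism between them which
is a morphism of varieties in both directions. -/
def AlgGroupIsomorphic {m n : ℕ} (H : Subgroup (GL (Fin m) ℂ)) (K : Subgroup (GL (Fin n) ℂ)) :
    Prop :=
  ∃ φ : H ≃* K, (∀ f ∈ regularFunctions K, (fun h => f (φ h)) ∈ regularFunctions H) ∧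
    ∀ f ∈ regularFunctions H, (fun k => f (φ.symm k)) ∈ regularFunctions K

/-- `SL₂(ℂ)` as a subgroup of `GL₂(ℂ)`. -/
def algSL2 : Subgroup (GL (Fin 2) ℂ) :=
  (Matrix.SpecialLinearGroup.toGL (n := Fin 2) (R := ℂ)).range

/-- Left translations are continuous in the Zariski topology. -/
theorem continuous_zariski_mul_left {n : ℕ} (a : GL (Fin n) ℂ) :
    Continuous[zariskiTopology n, zariskiTopology n] (fun g => a * g) := by
  let _ := zariskiTopology n
  refine continuous_def.2 fun O hO => ?_
  obtain ⟨S, hS⟩ : ∃ S, Oᶜ = glZeroLocus S := hO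
  refine show ∃ S, ((fun g => a * g) ⁻¹' O)ᶜ = glZeroLocus S from
    ⟨{q | ∃ p ∈ S, q = MvPolynomial.bind₁ (fun ij : Fin n × Fin n =>
      ∑ k, MvPolynomial.C ((a : Matrix (Fin n) (Fin n) ℂ) ij.1 k) *
        MvPolynomial.X (k, ij.2)) p}, ?_⟩
  rw [← Set.preimage_compl, hS]
  have key : ∀ (p : MvPolynomial (Fin n × Fin n) ℂ) (g : GL (Fin n) ℂ),
      MvPolynomial.eval (fun ij => (g : Matrix (Fin n) (Fin n) ℂ) ij.1 ij.2)
        (MvPolynomial.bind₁ (fun ij : Fin n × Fin n =>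
          ∑ k, MvPolynomial.C ((a : Matrix (Fin n) (Fin n) ℂ) ij.1 k) *
            MvPolynomial.X (k, ij.2)) p) =
      MvPolynomial.eval
        (fun ij => ((a * g : GL (Fin n) ℂ) : Matrix (Fin n) (Fin n) ℂ) ij.1 ij.2) p := by
    intro p g
    rw [← MvPolynomial.coe_aeval_eq_eval, RingHom.coe_coe, MvPolynomial.aeval_bind₁,
      ← MvPolynomial.coe_aeval_eq_eval, RingHom.coe_coe]
    congr 2
    ext ij
    simp [Matrix.mul_apply]
  ext g
  simp only [Set.mem_preimage, glZeroLocus, Set.mem_ofPred_eq]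
  constructor
  · rintro h q ⟨p, hp, rfl⟩
    rw [key]
    exact h p hp
  · intro h p hp
    rw [← key]
    exact h _ ⟨p, hp, rfl⟩

/-- The connected component of `1` in `G`, in the Zariski topology, is stable under left
translation by the inverses of its elements. -/
theorem inv_mul_mem_zariski_component {n : ℕ} {G : Subgroup (GL (Fin n) ℂ)} {g h : GL (Fin n) ℂ}
    (hg : g ∈ @connectedComponentIn _ (zariskiTopology n) (G : Set (GL (Fin n) ℂ)) 1)
    (hh : h ∈ @connectedComponentIn _ (zariskiTopology n) (G : Set (GL (Fin n) ℂ)) 1) :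
    g⁻¹ * h ∈ @connectedComponentIn _ (zariskiTopology n) (G : Set (GL (Fin n) ℂ)) 1 := by
  let _ := zariskiTopology n
  have hgG : g ∈ G := connectedComponentIn_subset _ _ hg
  refine (isPreconnected_connectedComponentIn.image (fun x => g⁻¹ * x)
    (continuous_zariski_mul_left g⁻¹).continuousOn).subset_connectedComponentIn
      ⟨g, hg, inv_mul_cancel g⟩ ?_ ⟨h, hh, rfl⟩
  rintro _ ⟨x, hx, rfl⟩
  exact G.mul_mem (G.inv_mem hgG) (connectedComponentIn_subset _ _ hx)

/-- The identity component `G⁰`: the connected component of `1` in `G` for the Zariski topology. -/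
def identityComponent {n : ℕ} (G : Subgroup (GL (Fin n) ℂ)) : Subgroup (GL (Fin n) ℂ) :=
  have one_mem : (1 : GL (Fin n) ℂ) ∈
      @connectedComponentIn _ (zariskiTopology n) (G : Set (GL (Fin n) ℂ)) 1 :=
    @mem_connectedComponentIn _ (zariskiTopology n) _ _ G.one_mem
  have inv_mem : ∀ {g : GL (Fin n) ℂ},
      g ∈ @connectedComponentIn _ (zariskiTopology n) (G : Set (GL (Fin n) ℂ)) 1 →
      g⁻¹ ∈ @connectedComponentIn _ (zariskiTopology n) (G : Set (GL (Fin n) ℂ)) 1 :=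
    fun {g} hg => mul_one g⁻¹ ▸ inv_mul_mem_zariski_component hg one_mem
  { carrier := @connectedComponentIn _ (zariskiTopology n) (G : Set (GL (Fin n) ℂ)) 1
    one_mem' := one_mem
    mul_mem' := fun {g h} hg hh => by
      simpa only [inv_inv] using inv_mul_mem_zariski_component (inv_mem hg) hh
    inv_mem' := inv_mem }

theorem identityComponent_le {n : ℕ} (G : Subgroup (GL (Fin n) ℂ)) : identityComponent G ≤ G :=
  @connectedComponentIn_subset _ (zariskiTopology n) _ _

/-! ### Modules and invariants -/

/-- A finite-dimensional representation is rational if its matrix coefficients are regular. -/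
def IsRationalRep {n : ℕ} {G : Subgroup (GL (Fin n) ℂ)} {V : Type*} [AddCommGroup V] [Module ℂ V]
    (ρ : Representation ℂ G V) : Prop :=
  ∀ (l : Module.Dual ℂ V) (v : V), (fun g : G => l (ρ g v)) ∈ regularFunctions G

/-- The restriction of a `G`-module to the identity component `G⁰`. -/
def restrictIdentityComponent {n : ℕ} {G : Subgroup (GL (Fin n) ℂ)} {V : Type*} [AddCommGroup V]
    [Module ℂ V] (ρ : Representation ℂ G V) : Representation ℂ (identityComponent G) V :=
  ρ.comp (Subgroup.inclusion (identityComponent_le G))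

/-- The algebra `ℂ[V]` of polynomial functions on `V`, generated by the linear functions. -/
def polyFunctions (V : Type*) [AddCommGroup V] [Module ℂ V] : Subalgebra ℂ (V → ℂ) :=
  Algebra.adjoin ℂ {f | ∃ l : Module.Dual ℂ V, f = fun v => l v}

/-- The algebra `ℂ[V]^G` of invariant polynomial functions on a `G`-module `V`. -/
def invariantPolynomials {G V : Type*} [Group G] [AddCommGroup V] [Module ℂ V]
    (ρ : Representation ℂ G V) : Subalgebra ℂ (V → ℂ) where
  carrier := {f | f ∈ polyFunctions V ∧ ∀ g v, f (ρ g v) = f v}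
  mul_mem' := fun ha hb => ⟨mul_mem ha.1 hb.1, fun g v => by simp [ha.2 g v, hb.2 g v]⟩
  add_mem' := fun ha hb => ⟨add_mem ha.1 hb.1, fun g v => by simp [ha.2 g v, hb.2 g v]⟩
  algebraMap_mem' := fun c => ⟨algebraMap_mem _ c, fun _ _ => rfl⟩

/-- The `G`-module `kV`, the direct sum of `k` copies of `V`. -/
def copies {G V : Type*} [Group G] [AddCommGroup V] [Module ℂ V] (ρ : Representation ℂ G V)
    (k : ℕ) : Representation ℂ G (Fin k → V) where
  toFun g := (ρ g).compLeft (Fin k)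
  map_one' := by ext; simp
  map_mul' g h := by ext; simp

/-! ### Polarization -/

/-- A function `f` is homogeneous of degree `d`. -/
def IsHomogeneousFunction {V : Type*} [AddCommGroup V] [Module ℂ V] (f : V → ℂ) (d : ℕ) : Prop :=
  ∀ (c : ℂ) (v : V), f (c • v) = c ^ d * f v

/-- `F` is the family `(f_α)` of polarizations to `k` copies of `V` of a homogeneous polynomial
function `f` of degree `d`: `f (∑ᵢ sᵢ vᵢ) = ∑_{|α| = d} s^α f_α(v₁, …, vₖ)`. This identity in `s`
determines `f_α` for `|α| = d`; the other values of the family are irrelevant. -/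
def IsPolarizationFamily {V : Type*} [AddCommGroup V] [Module ℂ V] (k d : ℕ) (f : V → ℂ)
    (F : (Fin k → ℕ) → (Fin k → V) → ℂ) : Prop :=
  ∀ (s : Fin k → ℂ) (v : Fin k → V),
    f (∑ i, s i • v i) =
      ∑ α ∈ Finset.piAntidiag (Finset.univ : Finset (Fin k)) d, (∏ i, s i ^ α i) * F α v

/-- The algebra `pol_k(V)^G` generated by the polarizations to `kV` of the homogeneous elements of
`ℂ[V]^G`. -/
def polarizationAlgebra {G V : Type*} [Group G] [AddCommGroup V] [Module ℂ V]
    (ρ : Representation ℂ G V) (k : ℕ) : Subalgebra ℂ ((Fin k → V) → ℂ) :=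
  Algebra.adjoin ℂ {p | ∃ f ∈ invariantPolynomials ρ, ∃ d, IsHomogeneousFunction f d ∧
    ∃ F, IsPolarizationFamily k d f F ∧
      ∃ α ∈ Finset.piAntidiag (Finset.univ : Finset (Fin k)) d, p = F α}

/-- The `k`-polarization property: `pol_k(V)^G = ℂ[kV]^G`. -/
def HasPolarizationProperty {G V : Type*} [Group G] [AddCommGroup V] [Module ℂ V]
    (ρ : Representation ℂ G V) (k : ℕ) : Prop :=
  polarizationAlgebra ρ k = invariantPolynomials (copies ρ k)

/-! The identity component has finite index and every algebraic automorphism of SL₂ is inner, so G =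
SL₂ · C with C the centralizer of SL₂. It is finite and contains -1 (`exists_decomposition`). Let W
be the space of lowest weight vectors of weight -j in V. It is nonzero because V contains R_j, it is
stable under C, and -1 acts on it as (-1)^j = -1.

Since C is finite, there are nonzero C-invariant polynomials of positive degree on W. Choose one, ψ,
of least positive degree d. The action of -1 forces d = 2m. Fix w in W with ψ(w) ≠ 0 and put y = e^j
w, a highest weight vector.

An invariant of 2V. Functionals l, l' on W extend to functionals on V that behave like lowest weight
vectors of the dual, and Σ (-1)^k l(f^k v) l'(f^(j-k) v') is an SL₂-invariant bilinear form. At (w,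
y) it equals a fixed nonzero multiple of l(w) l'(w). At (w + y, w + y) it vanishes because j is odd.
Products of m such forms therefore give an F of bidegree (m, m) with F(w, y) = ψ(w) on all of W
(`SL2Action.exists_lift`), and summing over C gives a G-invariant H with H(w, y) = |C| ψ(w) ≠ 0 and
H(w + y, w + y) = 0.

A constraint on polarizations. Let q be a homogeneous invariant on V. For fixed a, b the function w
↦ q(a w + b e^j w) is a C-invariant on W, so it vanishes if 0 < deg q < 2m. If deg q = 2m,
invariance under the torus gives q(a w + b y) = (a b)^m q(w + y). Hence the polarization of index
(m, m) is q(w + y) at (w, y) and binom(2m, m) q(w + y) at (w + y, w + y). A product of two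
invariants of positive degree has no terms of degree at most 2m along these lines, so the
proportionality of the (m, m)-coefficients, with factor binom(2m, m), passes to the whole algebra of
polarizations (`polarizationAlgebra_le_compatibleFunctions`). The invariant H violates it. -/

namespace SL2

open Finset Module

/-! ### Expansions of vector-valued functions along a family of scalar functions -/

section Expansion

variable {X K M : Type*} [AddCommGroup M] [Module ℂ M]

/-- Coefficients along linearly independent functions lie in every subspace containing all values. -/
theorem coeff_mem_of_sum_mem {χ : K → X → ℂ} (hχ : LinearIndependent ℂ χ) (s : Finset K)
    (E : K → M) (N : Submodule ℂ M) (h : ∀ x, ∑ k ∈ s, χ k x • E k ∈ N) :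
    ∀ k ∈ s, E k ∈ N := by
  intro k hk
  by_contra hkN
  -- A functional killing `N` but not `E k` turns the vector statement into a scalar linear relation
  -- among the `χ k`.
  obtain ⟨l, hl, hN⟩ := Submodule.exists_le_ker_of_notMem hkN
  refine hl (linearIndependent_iff'.1 hχ s (fun k => l (E k)) ?_ k hk)
  funext x
  have := hN (h x)
  rw [LinearMap.mem_ker, map_sum] at this
  simpa [mul_comm] using this

theorem coeff_eq_of_sum_eq {χ : K → X → ℂ} (hχ : LinearIndependent ℂ χ) (s : Finset K)
    (A B : K → M) (h : ∀ x, ∑ k ∈ s, χ k x • A k = ∑ k ∈ s, χ k x • B k) :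
    ∀ k ∈ s, A k = B k := by
  intro k hk
  have := coeff_mem_of_sum_mem hχ s (fun k => A k - B k) ⊥ (fun x => by
    simp [smul_sub, h x]) k hk
  simpa [sub_eq_zero] using this

/-- A function with values in a finite-dimensional space whose coordinates are combinations of the
`χ k` is a combination of the `χ k` with vector coefficients. -/
theorem exists_expansion [FiniteDimensional ℂ M] {χ : K → X → ℂ} (Φ : X → M)
    (h : ∀ l : Dual ℂ M, (fun x => l (Φ x)) ∈ Submodule.span ℂ (Set.range χ)) :
    ∃ (s : Finset K) (E : K → M), (∀ k ∉ s, E k = 0) ∧ ∀ x, Φ x = ∑ k ∈ s, χ k x • E k := by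
  classical
  let b := Module.finBasis ℂ M
  choose c hc using fun i => (Finsupp.mem_span_range_iff_exists_finsupp.1 (h (b.coord i)))
  refine ⟨univ.biUnion fun i => (c i).support, fun k => ∑ i, c i k • b i, ?_, fun x => ?_⟩
  · intro k hk
    refine sum_eq_zero fun i _ => ?_
    have : k ∉ (c i).support := fun h => hk (mem_biUnion.2 ⟨i, mem_univ _, h⟩)
    simp [Finsupp.notMem_support_iff.1 this]
  · conv_lhs => rw [← b.sum_repr (Φ x)]
    simp_rw [smul_sum, smul_smul]
    rw [sum_comm]
    refine sum_congr rfl fun i _ => ?_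
    rw [← sum_smul]
    congr 1
    have := congrFun (hc i) x
    simp only [Basis.coord_apply] at this
    rw [← this, Finsupp.sum, Finset.sum_apply]
    simp only [Pi.smul_apply, smul_eq_mul]
    simp_rw [mul_comm (χ _ x)]
    refine sum_subset (fun k hk => mem_biUnion.2 ⟨i, mem_univ _, hk⟩) fun k _ hk => ?_
    simp [Finsupp.notMem_support_iff.1 hk]

end Expansion

/-! ### Independence of power functions -/

theorem linearIndependent_pow : LinearIndependent ℂ (fun (k : ℕ) (t : ℂ) => t ^ k) := by
  -- Dedekind's theorem: distinct multiplicative characters are independent. The value at 2 tells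
  -- the exponents apart.
  refine (linearIndependent_monoidHom ℂ ℂ).comp (fun k : ℕ => powMonoidHom k) fun k l h => ?_
  have := DFunLike.congr_fun h 2
  simp only [powMonoidHom_apply] at this
  exact Nat.pow_right_injective le_rfl (by exact_mod_cast this)

theorem linearIndependent_zpow :
    LinearIndependent ℂ (fun (k : ℤ) (t : ℂˣ) => ((t : ℂ) ^ k)) := by
  have h := (linearIndependent_monoidHom ℂˣ ℂ).comp
    (fun k : ℤ => (Units.coeHom ℂ).comp (zpowGroupHom k)) fun k l h => by
      have := DFunLike.congr_fun h (Units.mk0 2 two_ne_zero)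
      simp only [MonoidHom.comp_apply, zpowGroupHom_apply, Units.coeHom_apply,
        Units.val_zpow_eq_zpow_val, Units.val_mk0] at this
      have h2 : (2 : ℝ) ^ k = 2 ^ l := by simpa using congrArg norm this
      exact zpow_right_injective₀ (by norm_num) (by norm_num) h2
  have e : (fun (k : ℤ) (t : ℂˣ) => ((t : ℂ) ^ k)) = (fun f : ℂˣ →* ℂ => (f : ℂˣ → ℂ)) ∘
      fun k : ℤ => (Units.coeHom ℂ).comp (zpowGroupHom k) := by
    funext k t
    simp
  rw [e]
  exact h

/-! ### One-parameter subgroups -/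

/-- The upper unipotent matrices. -/
def upper (t : ℂ) : SL(2, ℂ) := ⟨!![1, t; 0, 1], by simp [Matrix.det_fin_two]⟩

/-- The lower unipotent matrices. -/
def lower (t : ℂ) : SL(2, ℂ) := ⟨!![1, 0; t, 1], by simp [Matrix.det_fin_two]⟩

/-- The diagonal matrices. -/
def torus (t : ℂˣ) : SL(2, ℂ) := ⟨!![(t : ℂ), 0; 0, ((t⁻¹ : ℂˣ) : ℂ)], by simp [Matrix.det_fin_two]⟩

@[simp] theorem coe_upper (t : ℂ) : (upper t : Matrix (Fin 2) (Fin 2) ℂ) = !![1, t; 0, 1] := rfl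

theorem upper_add (s t : ℂ) : upper (s + t) = upper s * upper t := by
  ext i j
  fin_cases i <;> fin_cases j <;> simp [Matrix.mul_apply, Fin.sum_univ_two, add_comm]

@[simp] theorem coe_lower (t : ℂ) : (lower t : Matrix (Fin 2) (Fin 2) ℂ) = !![1, 0; t, 1] := rfl

theorem lower_add (s t : ℂ) : lower (s + t) = lower s * lower t := by
  ext i j
  fin_cases i <;> fin_cases j <;> simp [Matrix.mul_apply, Fin.sum_univ_two]

theorem upper_zero : upper 0 = 1 := by
  ext i j
  fin_cases i <;> fin_cases j <;> simp

theorem lower_zero : lower 0 = 1 := by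
  ext i j
  fin_cases i <;> fin_cases j <;> simp

@[simp] theorem coe_torus (t : ℂˣ) :
    (torus t : Matrix (Fin 2) (Fin 2) ℂ) = !![(t : ℂ), 0; 0, ((t⁻¹ : ℂˣ) : ℂ)] := rfl

theorem torus_mul (s t : ℂˣ) : torus (s * t) = torus s * torus t := by
  ext i j
  fin_cases i <;> fin_cases j <;> simp [Matrix.mul_apply, Fin.sum_univ_two, mul_comm]

theorem torus_one : torus 1 = 1 := by
  ext i j
  fin_cases i <;> fin_cases j <;> simp

theorem torus_neg_one : torus (-1) = -1 := by
  ext i j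
  fin_cases i <;> fin_cases j <;> simp

theorem torus_mul_upper (s : ℂˣ) (t : ℂ) :
    torus s * upper t = upper ((s : ℂ) ^ 2 * t) * torus s := by
  ext i j
  fin_cases i <;> fin_cases j <;> simp [Matrix.mul_apply, Fin.sum_univ_two]
  field_simp

theorem torus_mul_lower (s : ℂˣ) (t : ℂ) :
    torus s * lower ((s : ℂ) ^ 2 * t) = lower t * torus s := by
  ext i j
  fin_cases i <;> fin_cases j <;> simp [Matrix.mul_apply, Fin.sum_univ_two]
  field_simp

/-- `SL₂` is generated by the unipotent matrices. -/
theorem unipotent_induction {p : SL(2, ℂ) → Prop} (hu : ∀ t, p (upper t)) (hl : ∀ t, p (lower t))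
    (hmul : ∀ a b, p a → p b → p (a * b)) (g : SL(2, ℂ)) : p g := by
  have key : ∀ g : SL(2, ℂ), g.1 1 0 ≠ 0 → p g := by
    intro g hg
    have hdet : g.1 0 0 * g.1 1 1 - g.1 0 1 * g.1 1 0 = 1 := by
      rw [← Matrix.det_fin_two]; exact g.2
    have : g = upper ((g.1 0 0 - 1) / g.1 1 0) * lower (g.1 1 0) *
        upper ((g.1 1 1 - 1) / g.1 1 0) := by
      ext i j
      fin_cases i <;> fin_cases j <;> simp [Matrix.mul_apply, Fin.sum_univ_two] <;> field_simp <;>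
        try (first | linear_combination -hdet | ring)
    rw [this]
    exact hmul _ _ (hmul _ _ (hu _) (hl _)) (hu _)
  by_cases hg : g.1 1 0 = 0
  · have hdet : g.1 0 0 * g.1 1 1 - g.1 0 1 * g.1 1 0 = 1 := by
      rw [← Matrix.det_fin_two]; exact g.2
    have h1 : g.1 1 1 ≠ 0 := by
      intro h
      simp [h, hg] at hdet
    have : g = (g * lower 1) * lower (-1) := by
      rw [mul_assoc, ← lower_add, add_neg_cancel, lower_zero, mul_one]
    rw [this]
    refine hmul _ _ (key _ ?_) (hl _)
    simpa [Matrix.mul_apply, Fin.sum_univ_two, hg] using h1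
  · exact key g hg

end SL2

namespace SL2

open Finset Module

/-! ### The `sl₂`-triple of a polynomial representation of `SL₂` -/

section Unipotent

variable {A : Type*} [Ring A] [Algebra ℂ A]

/-- `U` is the exponential one-parameter group generated by the nilpotent element `e`. -/
def IsExpOf (U : ℂ → A) (e : A) : Prop :=
  ∃ N : ℕ, e ^ N = 0 ∧ ∀ t, U t = ∑ k ∈ range N, (t ^ k / (k.factorial : ℂ)) • e ^ k

/-- Adding zero terms to the exponential sum is harmless. With m = 2 the linear term is guaranteed
to occur in it. -/
theorem IsExpOf.of_le {U : ℂ → A} {e : A} (h : IsExpOf U e) (m : ℕ) :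
    ∃ N : ℕ, m ≤ N ∧ e ^ N = 0 ∧ ∀ t, U t = ∑ k ∈ range N, (t ^ k / (k.factorial : ℂ)) • e ^ k := by
  obtain ⟨N, hN, hU⟩ := h
  refine ⟨max m N, le_max_left _ _, pow_eq_zero_of_le (le_max_right _ _) hN, fun t => ?_⟩
  rw [hU t]
  refine sum_subset (range_mono (le_max_right _ _)) fun k _ hk => ?_
  rw [pow_eq_zero_of_le (by simpa using hk) hN, smul_zero]

theorem hasDerivAt_sum_pow (N : ℕ) (hN : 2 ≤ N) (c : ℕ → ℂ) :
    HasDerivAt (fun t : ℂ => ∑ k ∈ range N, t ^ k * c k) (c 1) 0 := by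
  have h := HasDerivAt.fun_sum (u := range N) (A := fun k (t : ℂ) => t ^ k * c k)
    (fun k _ => (hasDerivAt_pow k (0 : ℂ)).mul_const (c k))
  refine h.congr_deriv ?_
  rw [sum_eq_single_of_mem 1 (by simp; omega)]
  · simp
  · intro k _ hk
    rcases k with _ | _ | k <;> simp_all

/-- Differentiation is tested against linear functionals, so that no topology on `A` is needed. -/
theorem IsExpOf.hasDerivAt {U : ℂ → A} {e : A} (h : IsExpOf U e) (l : A →ₗ[ℂ] ℂ) :
    HasDerivAt (fun t => l (U t)) (l e) 0 := by
  obtain ⟨N, h2, hN, hU⟩ := h.of_le 2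
  have := hasDerivAt_sum_pow N h2 fun k => l (e ^ k) / (k.factorial : ℂ)
  simp only [pow_one, Nat.factorial_one, Nat.cast_one, div_one] at this
  convert this using 2 with t
  rw [hU t, map_sum]
  refine sum_congr rfl fun k _ => ?_
  rw [map_smul, smul_eq_mul]
  ring

/-- A polynomial one-parameter group is the exponential of its linear coefficient. The coefficient
of s in U(s + t) = U(s) U(t) gives E₁ U(t) = U'(t), then the coefficients in t give E₁ E_k = (k + 1)
E_(k+1), so E_k = E₁^k / k!. As only finitely many E_k are nonzero, E₁ is nilpotent. -/
theorem isExpOf_of_expansion {U : ℂ → A} (hadd : ∀ s t, U (s + t) = U s * U t) (h0 : U 0 = 1)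
    (h : ∃ (s : Finset ℕ) (E : ℕ → A), (∀ k ∉ s, E k = 0) ∧ ∀ x : ℂ, U x = ∑ k ∈ s, x ^ k • E k) :
    ∃ e, e ∈ Submodule.span ℂ (Set.range U) ∧ IsExpOf U e := by
  obtain ⟨s, E, hs, hE⟩ := h
  obtain ⟨N, hN2, hN⟩ : ∃ N, 2 ≤ N ∧ ∀ k, N ≤ k → E k = 0 := by
    refine ⟨s.sup id + 2, by omega, fun k hk => hs k fun hks => ?_⟩
    have := le_sup (f := id) hks
    simp only [id] at this
    omega
  have hU : ∀ t, U t = ∑ k ∈ range N, t ^ k • E k := by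
    intro t
    rw [hE t]
    have h1 : ∑ k ∈ s, t ^ k • E k = ∑ k ∈ s ∪ range N, t ^ k • E k :=
      sum_subset subset_union_left fun k _ hk => by rw [hs k hk, smul_zero]
    have h2 : ∑ k ∈ range N, t ^ k • E k = ∑ k ∈ s ∪ range N, t ^ k • E k :=
      sum_subset subset_union_right fun k _ hk => by rw [hN k (by simpa using hk), smul_zero]
    rw [h1, h2]
  have hE0 : E 0 = 1 := by
    rw [← h0, hU 0, sum_eq_single_of_mem 0 (by simp; omega)]
    · simp
    · intro k _ hk
      simp [hk]
  have hmem : E 1 ∈ Submodule.span ℂ (Set.range U) :=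
    coeff_mem_of_sum_mem linearIndependent_pow (range N) E _ (fun t => by
      rw [← hU t]; exact Submodule.subset_span ⟨t, rfl⟩) 1 (by simp; omega)
  have h1 : ∀ t, E 1 * U t = ∑ n ∈ range N, ((n : ℂ) * t ^ (n - 1)) • E n := by
    intro t
    have := coeff_eq_of_sum_eq linearIndependent_pow (range N) (fun k => E k * U t)
      (fun k => ∑ n ∈ range N, (t ^ (n - k) * (n.choose k : ℂ)) • E n) (fun x => by
        simp_rw [← smul_mul_assoc]
        rw [← sum_mul, ← hU x, ← hadd, hU]
        simp_rw [smul_sum]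
        rw [sum_comm]
        refine sum_congr rfl fun n hn => ?_
        rw [add_pow, sum_smul]
        refine sum_subset_zero_on_sdiff (range_mono (by simp at hn; omega)) (fun k hk => ?_)
          fun k _ => ?_
        · rw [Nat.choose_eq_zero_of_lt (by simp at hk; omega)]
          simp
        · rw [smul_smul, mul_assoc]) 1 (by simp; omega)
    simpa [mul_comm] using this
  have hrec : ∀ k, E 1 * E k = ((k : ℂ) + 1) • E (k + 1) := by
    have h2 : ∀ k ∈ range N, E 1 * E k = ((k : ℂ) + 1) • E (k + 1) := by
      refine coeff_eq_of_sum_eq linearIndependent_pow (range N) _ _ fun t => ?_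
      simp_rw [← mul_smul_comm]
      rw [← mul_sum, ← hU t, h1 t]
      simp_rw [smul_smul]
      obtain ⟨M, rfl⟩ : ∃ M, N = M + 1 := ⟨N - 1, by omega⟩
      rw [sum_range_succ', sum_range_succ]
      simp [hN (M + 1) le_rfl, mul_comm]
    intro k
    by_cases hk : k < N
    · exact h2 k (by simpa using hk)
    · rw [hN k (by omega), hN (k + 1) (by omega), mul_zero, smul_zero]
  have hpow : ∀ k, E 1 ^ k = (k.factorial : ℂ) • E k := by
    intro k
    induction k with
    | zero => simp [hE0]
    | succ k ih =>
      rw [pow_succ', ih, mul_smul_comm, hrec, smul_smul, Nat.factorial_succ]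
      push_cast
      rw [mul_comm]
  refine ⟨E 1, hmem, N, ?_, fun t => ?_⟩
  · rw [hpow, hN N le_rfl, smul_zero]
  · rw [hU t]
    refine sum_congr rfl fun k _ => ?_
    rw [hpow, smul_smul, div_mul_cancel₀ _ (by exact_mod_cast k.factorial_ne_zero)]

end Unipotent

variable {V : Type*} [AddCommGroup V] [Module ℂ V]

/-- The matrix coefficients of a polynomial representation of `SL₂` are polynomials in the matrix
entries. -/
def IsPolynomialRep (R : Representation ℂ SL(2, ℂ) V) : Prop :=
  ∀ l : Dual ℂ (End ℂ V), ∃ p : MvPolynomial (Fin 2 × Fin 2) ℂ, ∀ g : SL(2, ℂ),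
    l (R g) = MvPolynomial.eval (fun ij => (g : Matrix (Fin 2) (Fin 2) ℂ) ij.1 ij.2) p

/-- The infinitesimal operators `e`, `f` and the weight projections `P` of a representation of
`SL₂`. -/
structure SL2Action (R : Representation ℂ SL(2, ℂ) V) (e f : End ℂ V) (P : ℤ → End ℂ V) :
    Prop where
  e_mem : e ∈ Submodule.span ℂ (Set.range R)
  f_mem : f ∈ Submodule.span ℂ (Set.range R)
  P_mem : ∀ k, P k ∈ Submodule.span ℂ (Set.range R)
  upper_eq : IsExpOf (fun t => R (upper t)) e
  lower_eq : IsExpOf (fun t => R (lower t)) f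
  torus_P : ∀ t k, R (torus t) * P k = ((t : ℂ) ^ k) • P k
  P_mul : ∀ k l, P k * P l = if k = l then P l else 0
  P_sum : ∃ S : Finset ℤ, ∑ k ∈ S, P k = 1
  e_P : ∀ k, e * P k = P (k + 2) * e
  f_P : ∀ k, f * P k = P (k - 2) * f
  bracket : ∀ k, e * f * P k - f * e * P k = (k : ℂ) • P k

theorem hasDerivAt_eval {σ : Type*} [Fintype σ] [DecidableEq σ] (p : MvPolynomial σ ℂ)
    {c : σ → ℂ → ℂ} {c' : σ → ℂ} (hc : ∀ i, HasDerivAt (c i) (c' i) 0) :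
    HasDerivAt (fun s => MvPolynomial.eval (fun i => c i s) p)
      (∑ i, c' i * MvPolynomial.eval (fun i => c i 0) (MvPolynomial.pderiv i p)) 0 := by
  induction p using MvPolynomial.induction_on with
  | C a => simpa using hasDerivAt_const (0 : ℂ) a
  | add p q hp hq =>
    simp only [map_add, mul_add, sum_add_distrib]
    exact hp.add hq
  | mul_X p j hp =>
    simp only [map_mul, MvPolynomial.eval_X]
    refine (hp.mul (hc j)).congr_deriv (Eq.symm ?_)
    simp only [Derivation.leibniz, MvPolynomial.pderiv_X, smul_eq_mul, map_add, map_mul,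
      MvPolynomial.eval_X, mul_add, sum_add_distrib, sum_mul]
    rw [add_comm]
    congr 1
    · exact sum_congr rfl fun i _ => by ring
    · rw [sum_eq_single_of_mem j (mem_univ _)]
      · simp [mul_comm]
      · intro i _ hi
        simp [hi.symm]

variable [FiniteDimensional ℂ V] {R : Representation ℂ SL(2, ℂ) V}

theorem IsPolynomialRep.exists_upper (hR : IsPolynomialRep R) :
    ∃ e, e ∈ Submodule.span ℂ (Set.range fun t => R (upper t)) ∧
      IsExpOf (fun t => R (upper t)) e := by
  refine isExpOf_of_expansion (fun s t => by rw [upper_add, map_mul]) (by rw [upper_zero, map_one])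
    (exists_expansion _ fun l => ?_)
  obtain ⟨p, hp⟩ := hR l
  -- The factor `0 ^ d (1, 0)` comes from the zero entry of the matrix: since 0 ^ 0 = 1, it keeps
  -- exactly the monomials free of that entry.
  have : (fun x => l (R (upper x))) = ∑ d ∈ p.support,
      (MvPolynomial.coeff d p * 0 ^ d (1, 0)) • fun x : ℂ => x ^ d (0, 1) := by
    funext x
    rw [hp, MvPolynomial.eval_eq', Finset.sum_apply]
    refine sum_congr rfl fun d _ => ?_
    simp [Fintype.prod_prod_type, Fin.prod_univ_two]
    ring
  rw [this]
  exact Submodule.sum_mem _ fun d _ => Submodule.smul_mem _ _ (Submodule.subset_span ⟨_, rfl⟩)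

theorem IsPolynomialRep.exists_lower (hR : IsPolynomialRep R) :
    ∃ f, f ∈ Submodule.span ℂ (Set.range fun t => R (lower t)) ∧
      IsExpOf (fun t => R (lower t)) f := by
  refine isExpOf_of_expansion (fun s t => by rw [lower_add, map_mul]) (by rw [lower_zero, map_one])
    (exists_expansion _ fun l => ?_)
  obtain ⟨p, hp⟩ := hR l
  have : (fun x => l (R (lower x))) = ∑ d ∈ p.support,
      (MvPolynomial.coeff d p * 0 ^ d (0, 1)) • fun x : ℂ => x ^ d (1, 0) := by
    funext x
    rw [hp, MvPolynomial.eval_eq', Finset.sum_apply]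
    refine sum_congr rfl fun d _ => ?_
    simp [Fintype.prod_prod_type, Fin.prod_univ_two]
    ring
  rw [this]
  exact Submodule.sum_mem _ fun d _ => Submodule.smul_mem _ _ (Submodule.subset_span ⟨_, rfl⟩)

theorem IsPolynomialRep.exists_torus (hR : IsPolynomialRep R) :
    ∃ (S : Finset ℤ) (P : ℤ → End ℂ V), (∀ k ∉ S, P k = 0) ∧
      ∀ t : ℂˣ, R (torus t) = ∑ k ∈ S, ((t : ℂ) ^ k) • P k := by
  refine exists_expansion (χ := fun (k : ℤ) (t : ℂˣ) => ((t : ℂ) ^ k)) _ fun l => ?_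
  obtain ⟨p, hp⟩ := hR l
  have : (fun x => l (R (torus x))) = ∑ d ∈ p.support,
      (MvPolynomial.coeff d p * 0 ^ d (0, 1) * 0 ^ d (1, 0)) •
        fun x : ℂˣ => (x : ℂ) ^ ((d (0, 0) : ℤ) - d (1, 1)) := by
    funext x
    rw [hp, MvPolynomial.eval_eq', Finset.sum_apply]
    refine sum_congr rfl fun d _ => ?_
    simp [Fintype.prod_prod_type, Fin.prod_univ_two, zpow_sub₀]
    ring
  rw [this]
  exact Submodule.sum_mem _ fun d _ => Submodule.smul_mem _ _ (Submodule.subset_span ⟨_, rfl⟩)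

/-- A polynomial representation of `SL₂` has an `sl₂`-triple. -/
theorem IsPolynomialRep.exists_action (hR : IsPolynomialRep R) :
    ∃ (e f : End ℂ V) (P : ℤ → End ℂ V), SL2Action R e f P := by
  obtain ⟨e, he, hu⟩ := hR.exists_upper
  obtain ⟨f, hf, hl⟩ := hR.exists_lower
  obtain ⟨S, P, hPS, hP⟩ := hR.exists_torus
  have hmono : ∀ {ι : Type} (φ : ι → SL(2, ℂ)),
      Submodule.span ℂ (Set.range fun t => R (φ t)) ≤ Submodule.span ℂ (Set.range R) :=
    fun φ => Submodule.span_mono (by rintro _ ⟨t, rfl⟩; exact ⟨φ t, rfl⟩)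
  have hPtorus : ∀ t k, R (torus t) * P k = ((t : ℂ) ^ k) • P k := by
    intro t k
    by_cases hk : k ∈ S
    · refine coeff_eq_of_sum_eq linearIndependent_zpow S (fun k => R (torus t) * P k)
        (fun k => ((t : ℂ) ^ k) • P k) (fun x => ?_) k hk
      simp_rw [← mul_smul_comm]
      rw [← mul_sum, ← hP x, ← map_mul, ← torus_mul, hP]
      refine sum_congr rfl fun k _ => ?_
      rw [smul_smul, Units.val_mul, mul_zpow, mul_comm]
    · simp [hPS k hk]
  have hPmul : ∀ k l, P k * P l = if k = l then P l else 0 := by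
    intro k l
    by_cases hk : k ∈ S
    · refine coeff_eq_of_sum_eq linearIndependent_zpow S (fun k => P k * P l)
        (fun k => if k = l then P l else 0) (fun x => ?_) k hk
      simp_rw [← smul_mul_assoc]
      rw [← sum_mul, ← hP x, hPtorus]
      by_cases hl' : l ∈ S
      · rw [sum_eq_single_of_mem l hl']
        · simp
        · intro b _ hb
          simp [hb]
      · rw [sum_eq_zero]
        · simp [hPS l hl']
        · intro b hb
          rw [if_neg (by rintro rfl; exact hl' hb), smul_zero]
    · rw [hPS k hk, zero_mul]
      split_ifs with h
      · rw [← h, hPS k hk]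
      · rfl
  have hPsum : ∑ k ∈ S, P k = 1 := by
    have := hP 1
    rw [torus_one, map_one] at this
    simpa using this.symm
  have hPtorus' : ∀ t k, P k * R (torus t) = ((t : ℂ) ^ k) • P k := by
    intro t k
    rw [hP, mul_sum]
    by_cases hk : k ∈ S
    · rw [sum_eq_single_of_mem k hk]
      · rw [mul_smul_comm, hPmul, if_pos rfl]
      · intro b _ hb
        rw [mul_smul_comm, hPmul, if_neg hb.symm, smul_zero]
    · simp [hPS k hk]
  -- This is the coefficient of t in the relation `torus_mul_upper`.
  have hte : ∀ s : ℂˣ, R (torus s) * e = ((s : ℂ) ^ (2 : ℤ)) • (e * R (torus s)) := by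
    intro s
    obtain ⟨N, h2, -, hU⟩ := hu.of_le 2
    have := coeff_eq_of_sum_eq linearIndependent_pow (range N)
      (fun k => (1 / (k.factorial : ℂ)) • (R (torus s) * e ^ k))
      (fun k => ((s : ℂ) ^ 2) ^ k • (1 / (k.factorial : ℂ)) • (e ^ k * R (torus s))) (fun t => by
        have h3 := congrArg R (torus_mul_upper s t)
        rw [map_mul, map_mul, hU, hU, mul_sum, sum_mul] at h3
        convert h3 using 2 with k _ k _
        · rw [mul_smul_comm, smul_smul, mul_one_div]
        · rw [smul_mul_assoc, smul_smul, smul_smul, mul_pow]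
          congr 1
          ring) 1 (by simp; omega)
    simpa using this
  have htf : ∀ s : ℂˣ, ((s : ℂ) ^ (2 : ℤ)) • (R (torus s) * f) = f * R (torus s) := by
    intro s
    obtain ⟨N, h2, -, hU⟩ := hl.of_le 2
    have := coeff_eq_of_sum_eq linearIndependent_pow (range N)
      (fun k => ((s : ℂ) ^ 2) ^ k • (1 / (k.factorial : ℂ)) • (R (torus s) * f ^ k))
      (fun k => (1 / (k.factorial : ℂ)) • (f ^ k * R (torus s))) (fun t => by
        have h3 := congrArg R (torus_mul_lower s t)
        rw [map_mul, map_mul, hU, hU, mul_sum, sum_mul] at h3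
        convert h3 using 2 with k _ k _
        · rw [mul_smul_comm, smul_smul, smul_smul, mul_pow]
          congr 1
          ring
        · rw [smul_mul_assoc, smul_smul, mul_one_div]) 1 (by simp; omega)
    simpa using this
  -- An operator of weight m under the torus maps the weight space of k to that of k + m. Testing at
  -- s = 2 suffices, since the powers of 2 are distinct.
  have hshift : ∀ (a : End ℂ V) (m : ℤ),
      (∀ s : ℂˣ, R (torus s) * a = ((s : ℂ) ^ m) • (a * R (torus s))) →
      ∀ k, a * P k = P (k + m) * a := by
    intro a m ha k
    have hzero : ∀ l k, l ≠ k + m → P l * (a * P k) = 0 := by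
      intro l k hlk
      have h1 : ((2 : ℂ) ^ l) • (P l * (a * P k)) = ((2 : ℂ) ^ (k + m)) • (P l * (a * P k)) := by
        have h2 := hPtorus' (Units.mk0 2 two_ne_zero) l
        have h3 := hPtorus (Units.mk0 2 two_ne_zero) k
        have h4 := ha (Units.mk0 2 two_ne_zero)
        rw [Units.val_mk0] at h2 h3 h4
        rw [← smul_mul_assoc, ← h2, mul_assoc, ← mul_assoc _ a, h4, smul_mul_assoc, mul_assoc, h3,
          mul_smul_comm, mul_smul_comm, mul_smul_comm, smul_smul, zpow_add₀ two_ne_zero, mul_comm]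
      rw [← sub_eq_zero, ← sub_smul, smul_eq_zero, sub_eq_zero] at h1
      refine h1.resolve_left fun h => hlk ?_
      exact zpow_right_injective₀ (a := (2 : ℝ)) (by norm_num) (by norm_num)
        (by simpa using congrArg norm h)
    have h1 : a * P k = P (k + m) * (a * P k) := by
      conv_lhs => rw [← one_mul (a * P k), ← hPsum, sum_mul]
      by_cases hk : k + m ∈ S
      · exact sum_eq_single_of_mem _ hk fun b _ hb => hzero b k hb
      · rw [hPS _ hk, zero_mul]
        exact sum_eq_zero fun b hb => hzero b k (by rintro rfl; exact hk hb)
    have h2 : P (k + m) * a = P (k + m) * (a * P k) := by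
      conv_lhs => rw [← mul_one a, ← hPsum, mul_sum, mul_sum]
      by_cases hk : k ∈ S
      · exact sum_eq_single_of_mem _ hk fun b _ hb => hzero _ b (by simpa using hb.symm)
      · rw [hPS _ hk, mul_zero, mul_zero]
        exact sum_eq_zero fun b hb => hzero _ b (by
          intro h
          rw [add_left_inj] at h
          exact hk (h ▸ hb))
    rw [h1, h2]
  have heP : ∀ k, e * P k = P (k + 2) * e := hshift e 2 hte
  have hfP : ∀ k, f * P k = P (k - 2) * f := hshift f (-2) fun s => by
    rw [← htf s, smul_smul, ← zpow_add₀ s.ne_zero]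
    simp
  set H : End ℂ V := ∑ k ∈ S, (k : ℂ) • P k with hH
  -- This is the adjoint action of `upper t` on f. After applying a functional l, the map g ↦ l(R g)
  -- is a polynomial p in the entries, and each side becomes the derivative of p at 1 along a
  -- tangent vector.
  have hadj : ∀ t : ℂ, R (upper t) * f = (f + t • H - t ^ 2 • e) * R (upper t) := by
    intro t
    suffices h : R (upper t) * f * R (upper (-t)) = f + t • H - t ^ 2 • e by
      rw [← h, mul_assoc, ← map_mul, ← upper_add, neg_add_cancel, upper_zero, map_one, mul_one]
    rw [← sub_eq_zero, ← Module.forall_dual_apply_eq_zero_iff ℂ]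
    intro l
    obtain ⟨p, hp⟩ := hR l
    let D : Fin 2 → Fin 2 → ℂ := fun i j =>
      MvPolynomial.eval (fun ij => (1 : Matrix (Fin 2) (Fin 2) ℂ) ij.1 ij.2)
        (MvPolynomial.pderiv (i, j) p)
    have hcurve : ∀ (γ : ℂ → Matrix (Fin 2) (Fin 2) ℂ) (X : Matrix (Fin 2) (Fin 2) ℂ), γ 0 = 1 →
        (∀ i j, HasDerivAt (fun s => γ s i j) (X i j) 0) →
        HasDerivAt (fun s => MvPolynomial.eval (fun ij => γ s ij.1 ij.2) p)
          (∑ i, ∑ j, X i j * D i j) 0 := by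
      intro γ X h0 hX
      have := hasDerivAt_eval p (c := fun ij s => γ s ij.1 ij.2) (c' := fun ij => X ij.1 ij.2)
        fun ij => hX ij.1 ij.2
      rw [h0] at this
      simpa [Fintype.sum_prod_type] using this
    have hDe : l e = D 0 1 := by
      have h1 := hu.hasDerivAt l
      simp_rw [hp] at h1
      refine h1.unique ?_
      refine (hcurve (fun s => upper s) !![0, 1; 0, 0] (by rw [upper_zero]; rfl)
        fun i j => ?_).congr_deriv (by simp [Fin.sum_univ_two])
      fin_cases i <;> fin_cases j <;>
        simp [hasDerivAt_id', hasDerivAt_const]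
    have hDf : l f = D 1 0 := by
      have h1 := hl.hasDerivAt l
      simp_rw [hp] at h1
      refine h1.unique ?_
      refine (hcurve (fun s => lower s) !![0, 0; 1, 0] (by rw [lower_zero]; rfl)
        fun i j => ?_).congr_deriv (by simp [Fin.sum_univ_two])
      fin_cases i <;> fin_cases j <;>
        simp [hasDerivAt_id', hasDerivAt_const]
    have hDH : l H = D 0 0 - D 1 1 := by
      have hinv : HasDerivAt (fun s : ℂ => (1 + s)⁻¹) (-1) 0 := by
        have := ((hasDerivAt_id' (0 : ℂ)).const_add 1).fun_inv (by simp)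
        simpa using this
      have h1 : HasDerivAt (fun s : ℂ => ∑ k ∈ S, (1 + s) ^ k * l (P k)) (l H) 0 := by
        have h2 := HasDerivAt.fun_sum (u := S) (A := fun k (s : ℂ) => (1 + s) ^ k * l (P k))
          (x := 0) (A' := fun k => k * l (P k)) fun k _ => by
            have h3 := (hasDerivAt_zpow k (1 + 0 : ℂ) (by simp)).comp_const_add 1 0
            simpa using h3.mul_const (l (P k))
        refine h2.congr_deriv ?_
        simp [hH, map_sum]
      refine h1.unique ?_
      -- The torus is parametrized by 1 + s near s = 0, so that all curves pass through the identity
      -- at 0.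
      have h2 := hcurve (fun s => !![1 + s, 0; 0, (1 + s)⁻¹]) !![1, 0; 0, -1]
        (by ext i j; fin_cases i <;> fin_cases j <;> simp) fun i j => by
          fin_cases i <;> fin_cases j
          · simpa using (hasDerivAt_id' (0 : ℂ)).const_add 1
          · simp [hasDerivAt_const]
          · simp [hasDerivAt_const]
          · simpa using hinv
      refine (h2.congr_deriv (by simp [Fin.sum_univ_two]; ring)).congr_of_eventuallyEq ?_
      have hne : ∀ᶠ s : ℂ in 𝓝 0, 1 + s ≠ 0 :=
        (continuous_const.add continuous_id).continuousAt.eventually_ne (by simp)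
      filter_upwards [hne] with s hs
      have h3 := hp (torus (Units.mk0 (1 + s) hs))
      rw [hP, map_sum] at h3
      simpa using h3
    have hconj : l (R (upper t) * f * R (upper (-t))) = t * (D 0 0 - D 1 1) - t ^ 2 * D 0 1 +
        D 1 0 := by
      have h1 := hl.hasDerivAt (l ∘ₗ LinearMap.mulRight ℂ (R (upper (-t))) ∘ₗ
        LinearMap.mulLeft ℂ (R (upper t)))
      simp only [LinearMap.comp_apply, LinearMap.mulLeft_apply, LinearMap.mulRight_apply,
        ← map_mul, hp] at h1
      refine h1.unique ?_
      refine (hcurve (fun s => ((upper t * lower s * upper (-t) : SL(2, ℂ)) :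
        Matrix (Fin 2) (Fin 2) ℂ)) !![t, -t ^ 2; 1, -t] (by
          rw [lower_zero, mul_one, ← upper_add, add_neg_cancel, upper_zero]; rfl)
        fun i j => ?_).congr_deriv (by simp [Fin.sum_univ_two]; ring)
      have hlin : ∀ a b : ℂ, HasDerivAt (fun s : ℂ => a + b * s) b 0 := fun a b => by
        simpa using ((hasDerivAt_id' (0 : ℂ)).const_mul b).const_add a
      fin_cases i <;> fin_cases j
      · refine HasDerivAt.congr_of_eventuallyEq (hlin 1 t) (.of_forall fun s => ?_)
        simp [Matrix.mul_apply, Fin.sum_univ_two]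
      · refine HasDerivAt.congr_of_eventuallyEq (hlin 0 (-t ^ 2)) (.of_forall fun s => ?_)
        simp [Matrix.mul_apply, Fin.sum_univ_two]
        ring
      · refine HasDerivAt.congr_of_eventuallyEq (hlin 0 1) (.of_forall fun s => ?_)
        simp [Matrix.mul_apply, Fin.sum_univ_two]
      · refine HasDerivAt.congr_of_eventuallyEq (hlin 1 (-t)) (.of_forall fun s => ?_)
        simp [Matrix.mul_apply, Fin.sum_univ_two]
        ring
    rw [map_sub, hconj, map_sub, map_add, map_smul, map_smul, hDe, hDf, hDH]
    simp only [smul_eq_mul]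
    ring
  have hbracket : e * f - f * e = H := by
    rw [← sub_eq_zero, ← Module.forall_dual_apply_eq_zero_iff ℂ]
    intro l
    -- The bracket relation is the derivative of `hadj` at t = 0.
    have h1 := hu.hasDerivAt (l ∘ₗ LinearMap.mulRight ℂ f)
    simp only [LinearMap.comp_apply, LinearMap.mulRight_apply, hadj, sub_mul, add_mul, map_sub,
      map_add, smul_mul_assoc, map_smul, smul_eq_mul] at h1
    have ha := hu.hasDerivAt (l ∘ₗ LinearMap.mulLeft ℂ f)
    have hb := hu.hasDerivAt (l ∘ₗ LinearMap.mulLeft ℂ H)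
    have hc := hu.hasDerivAt (l ∘ₗ LinearMap.mulLeft ℂ e)
    have h2 := h1.unique ((ha.add ((hasDerivAt_id' (0 : ℂ)).mul hb)).sub
      ((hasDerivAt_pow 2 (0 : ℂ)).mul hc))
    simp [upper_zero] at h2
    simp [h2]
  refine ⟨e, f, P, hmono _ he, hmono _ hf, fun k => ?_, hu, hl, hPtorus, hPmul, ⟨S, hPsum⟩, heP,
    hfP, fun k => ?_⟩
  · by_cases hk : k ∈ S
    · exact coeff_mem_of_sum_mem linearIndependent_zpow S P _
        (fun t => by rw [← hP t]; exact Submodule.subset_span ⟨_, rfl⟩) k hk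
    · rw [hPS k hk]
      exact zero_mem _
  · rw [← sub_mul, hbracket, hH, sum_mul]
    by_cases hk : k ∈ S
    · rw [sum_eq_single_of_mem k hk]
      · rw [smul_mul_assoc, hPmul, if_pos rfl]
      · intro b _ hb
        rw [smul_mul_assoc, hPmul, if_neg hb, smul_zero]
    · simp [hPS k hk]

end SL2

namespace SL2

open Finset Module

variable {V : Type*} [AddCommGroup V] [Module ℂ V] {R : Representation ℂ SL(2, ℂ) V}
  {e f : End ℂ V} {P : ℤ → End ℂ V}

/-! ### Operators in the span of the group -/

theorem commute_of_mem_span {a x : End ℂ V} (hx : x ∈ Submodule.span ℂ (Set.range R))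
    (ha : ∀ g, Commute a (R g)) : Commute a x := by
  induction hx using Submodule.span_induction with
  | mem x hx => obtain ⟨g, rfl⟩ := hx; exact ha g
  | zero => exact Commute.zero_right a
  | add x y _ _ hx hy => exact hx.add_right hy
  | smul c x _ hx => exact hx.smul_right c

theorem apply_mem_of_mem_span {x : End ℂ V} (hx : x ∈ Submodule.span ℂ (Set.range R))
    {U : Submodule ℂ V} (hU : ∀ g, ∀ v ∈ U, R g v ∈ U) : ∀ v ∈ U, x v ∈ U := by
  intro v hv
  induction hx using Submodule.span_induction with
  | mem x hx => obtain ⟨g, rfl⟩ := hx; exact hU g v hv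
  | zero => exact zero_mem _
  | add x y _ _ hx hy => exact add_mem hx hy
  | smul c x _ hx => exact U.smul_mem c hx

theorem IsExpOf.apply_mem {F : ℂ → End ℂ V} {a : End ℂ V} (h : IsExpOf F a) {U : Submodule ℂ V}
    (hU : ∀ v ∈ U, a v ∈ U) (t : ℂ) : ∀ v ∈ U, F t v ∈ U := by
  intro v hv
  obtain ⟨N, -, hN⟩ := h
  have hpow : ∀ k : ℕ, (a ^ k) v ∈ U := by
    intro k
    induction k with
    | zero => simpa using hv
    | succ k ih => rw [pow_succ']; exact hU _ ih
  rw [hN t, LinearMap.sum_apply]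
  exact U.sum_mem fun k _ => U.smul_mem _ (hpow k)

/-- A bilinear form for which `a` is skew is invariant under `exp (t a)`. -/
theorem IsExpOf.bilin_invariant {F : ℂ → End ℂ V} {a : End ℂ V} (h : IsExpOf F a)
    (hadd : ∀ s t, F (s + t) = F s * F t) (h0 : F 0 = 1)
    (B : V →ₗ[ℂ] V →ₗ[ℂ] ℂ) (hB : ∀ v w, B (a v) w = -B v (a w)) (t : ℂ) (v w : V) :
    B (F t v) (F t w) = B v w := by
  obtain ⟨N, -, hN⟩ := h
  have hpow : ∀ (k : ℕ) (v w : V), B ((a ^ k) v) w = (-1) ^ k * B v ((a ^ k) w) := by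
    intro k
    induction k with
    | zero => simp
    | succ k ih =>
      intro v w
      have h1 : (a ^ (k + 1)) v = (a ^ k) (a v) := by rw [pow_succ, Module.End.mul_apply]
      have h2 : (a ^ (k + 1)) w = a ((a ^ k) w) := by rw [pow_succ', Module.End.mul_apply]
      rw [h1, h2, ih, hB]
      ring
  have hadj : ∀ v w, B (F t v) w = B v (F (-t) w) := by
    intro v w
    rw [hN, hN, LinearMap.sum_apply, LinearMap.sum_apply, map_sum, map_sum, LinearMap.sum_apply]
    refine sum_congr rfl fun k _ => ?_
    simp only [LinearMap.smul_apply, map_smul, smul_eq_mul, hpow, neg_pow t]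
    ring
  rw [hadj, ← Module.End.mul_apply, ← hadd, neg_add_cancel, h0, Module.End.one_apply]

namespace SL2Action

variable (h : SL2Action R e f P)

include h

theorem apply_mem_of_apply_mem {U : Submodule ℂ V} (he : ∀ v ∈ U, e v ∈ U)
    (hf : ∀ v ∈ U, f v ∈ U) (g : SL(2, ℂ)) : ∀ v ∈ U, R g v ∈ U := by
  induction g using unipotent_induction with
  | hu t => exact h.upper_eq.apply_mem he t
  | hl t => exact h.lower_eq.apply_mem hf t
  | hmul a b ha hb =>
    intro v hv
    rw [map_mul]
    exact ha _ (hb v hv)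

/-! ### Weight vectors -/

theorem weight_e {k : ℤ} {v : V} (hv : P k v = v) : P (k + 2) (e v) = e v := by
  have := LinearMap.congr_fun (h.e_P k) v
  simp only [Module.End.mul_apply, hv] at this
  exact this.symm

theorem weight_f {k : ℤ} {v : V} (hv : P k v = v) : P (k - 2) (f v) = f v := by
  have := LinearMap.congr_fun (h.f_P k) v
  simp only [Module.End.mul_apply, hv] at this
  exact this.symm

theorem weight_e_pow {k : ℤ} {v : V} (hv : P k v = v) (n : ℕ) :
    P (k + 2 * n) ((e ^ n) v) = (e ^ n) v := by
  induction n with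
  | zero => simpa using hv
  | succ n ih =>
    rw [pow_succ', Module.End.mul_apply]
    have := h.weight_e ih
    rwa [show k + 2 * (n : ℤ) + 2 = k + 2 * ((n + 1 : ℕ) : ℤ) by push_cast; ring] at this

theorem weight_f_pow {k : ℤ} {v : V} (hv : P k v = v) (n : ℕ) :
    P (k - 2 * n) ((f ^ n) v) = (f ^ n) v := by
  induction n with
  | zero => simpa using hv
  | succ n ih =>
    rw [pow_succ', Module.End.mul_apply]
    have := h.weight_f ih
    rwa [show k - 2 * (n : ℤ) - 2 = k - 2 * ((n + 1 : ℕ) : ℤ) by push_cast; ring] at this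

theorem weight_ne {k l : ℤ} {v : V} (hv : P k v = v) (hkl : l ≠ k) : P l v = 0 := by
  rw [← hv, ← Module.End.mul_apply, h.P_mul, if_neg hkl, LinearMap.zero_apply]

theorem torus_apply {k : ℤ} {v : V} (hv : P k v = v) (t : ℂˣ) :
    R (torus t) v = ((t : ℂ) ^ k) • v := by
  have := LinearMap.congr_fun (h.torus_P t k) v
  simpa only [Module.End.mul_apply, hv, LinearMap.smul_apply] using this

theorem e_f_apply {k : ℤ} {v : V} (hv : P k v = v) : e (f v) = f (e v) + (k : ℂ) • v := by
  have := LinearMap.congr_fun (h.bracket k) v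
  simp only [LinearMap.sub_apply, Module.End.mul_apply, hv, LinearMap.smul_apply] at this
  rw [← this]
  abel

/-- The classical recursion only needs f(e v) = 0 instead of e v = 0. This is what
`lowest_notMem_range` requires, where e v is itself a lowest weight vector. -/
theorem e_f_pow_apply {k : ℤ} {v : V} (hv : P k v = v) (hfe : f (e v) = 0) (n : ℕ) :
    e ((f ^ (n + 1)) v) = (((n : ℂ) + 1) * (k - n)) • (f ^ n) v := by
  induction n with
  | zero => simp [h.e_f_apply hv, hfe]
  | succ n ih =>
    rw [pow_succ', Module.End.mul_apply, h.e_f_apply (h.weight_f_pow hv (n + 1)), ih, map_smul,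
      ← Module.End.mul_apply, ← pow_succ', ← add_smul]
    congr 1
    push_cast
    ring

theorem f_e_pow_apply {k : ℤ} {v : V} (hv : P k v = v) (hf : f v = 0) (n : ℕ) :
    f ((e ^ (n + 1)) v) = (-((n : ℂ) + 1) * (k + n)) • (e ^ n) v := by
  have key : ∀ {k : ℤ} {v : V}, P k v = v → f (e v) = e (f v) - (k : ℂ) • v := fun hv => by
    rw [h.e_f_apply hv, add_sub_cancel_right]
  induction n with
  | zero => simp [key hv, hf]
  | succ n ih =>
    rw [pow_succ', Module.End.mul_apply, key (h.weight_e_pow hv (n + 1)), ih, map_smul,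
      ← Module.End.mul_apply, ← pow_succ', ← sub_smul]
    congr 1
    push_cast
    ring

theorem f_pow_e_pow_apply {k : ℤ} {v : V} (hv : P k v = v) (hf : f v = 0) (n : ℕ) :
    (f ^ n) ((e ^ n) v) = (∏ i ∈ range n, (-((i : ℂ) + 1) * (k + i))) • v := by
  induction n with
  | zero => simp
  | succ n ih =>
    rw [pow_succ f, Module.End.mul_apply, h.f_e_pow_apply hv hf, map_smul, ih, smul_smul,
      prod_range_succ, mul_comm]

/-- A lowest weight vector of non-positive weight is not in the range of `e`. -/
theorem lowest_notMem_range {j : ℕ} {w x : V} (hw : P (-j) w = w) (hf : f w = 0) (hx : e x = w) :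
    w = 0 := by
  set y := P (-j - 2) x with hy
  have hey : e y = w := by
    have := LinearMap.congr_fun (h.e_P (-j - 2)) x
    simpa [hx, hw] using this
  have hyw : P (-j - 2) y = y := by
    rw [hy, ← Module.End.mul_apply, h.P_mul, if_pos rfl]
  -- For weight -j - 2 the scalars (n + 1)(-j - 2 - n) never vanish, so the vanishing of f^(n+1) y
  -- descends to f^n y. Nilpotency of f starts the descent.
  have hdesc : ∀ n : ℕ, (f ^ n) y = 0 → y = 0 := by
    intro n
    induction n with
    | zero => exact fun h => by simpa using h
    | succ n ih =>
      intro hn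
      have := h.e_f_pow_apply hyw (by rw [hey, hf]) n
      rw [hn, map_zero, eq_comm, smul_eq_zero, mul_eq_zero] at this
      refine ih (this.resolve_left ?_)
      push Not
      refine ⟨by exact_mod_cast n.succ_ne_zero, ?_⟩
      have : ((-j - 2 : ℤ) : ℂ) - n = -((j + 2 + n : ℕ) : ℂ) := by push_cast; ring
      rw [this, neg_ne_zero]
      exact_mod_cast (by omega : j + 2 + n ≠ 0)
  obtain ⟨N, hN, -⟩ := h.lower_eq
  rw [← hey, hdesc N (by rw [hN, LinearMap.zero_apply]), map_zero]

/-- The structure of an irreducible representation of `SL₂`. -/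
theorem exists_lowest {U : Submodule ℂ V} (hU : ∀ g, ∀ v ∈ U, R g v ∈ U)
    (hirr : ∀ U' ≤ U, (∀ g, ∀ v ∈ U', R g v ∈ U') → U' ≠ ⊥ → U' = U) {j : ℕ}
    (hdim : finrank ℂ U = j + 1) :
    ∃ w ∈ U, w ≠ 0 ∧ f w = 0 ∧ P (-j) w = w ∧ (e ^ (j + 1)) w = 0 ∧
      LinearIndependent ℂ (fun i : Fin (j + 1) => (e ^ (i : ℕ)) w) ∧
      Submodule.span ℂ (Set.range fun i : Fin (j + 1) => (e ^ (i : ℕ)) w) = U := by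
  have heU := apply_mem_of_mem_span h.e_mem hU
  have hfU := apply_mem_of_mem_span h.f_mem hU
  have hPU := fun k => apply_mem_of_mem_span (h.P_mem k) hU
  obtain ⟨u, huU, hu⟩ : ∃ u ∈ U, u ≠ 0 := by
    refine U.ne_bot_iff.1 ?_
    rintro rfl
    simp at hdim
  obtain ⟨k, hk⟩ : ∃ k, P k u ≠ 0 := by
    by_contra! hc
    obtain ⟨S, hS⟩ := h.P_sum
    have := LinearMap.congr_fun hS u
    rw [LinearMap.sum_apply, sum_eq_zero fun k _ => hc k] at this
    exact hu this.symm
  have hfin : ∃ n : ℕ, (f ^ n) (P k u) = 0 := by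
    obtain ⟨N, hN, -⟩ := h.lower_eq
    exact ⟨N, by rw [hN, LinearMap.zero_apply]⟩
  classical
  obtain ⟨n, hn⟩ : ∃ n, Nat.find hfin = n + 1 := by
    refine Nat.exists_eq_succ_of_ne_zero fun h0 => ?_
    have := Nat.find_spec hfin
    rw [h0] at this
    exact hk (by simpa using this)
  set w := (f ^ n) (P k u) with hw
  have hw0 : w ≠ 0 := Nat.find_min hfin (by omega)
  have hfw : f w = 0 := by
    have := Nat.find_spec hfin
    rwa [hn, pow_succ', Module.End.mul_apply] at this
  have hpow : ∀ {a : End ℂ V}, (∀ v ∈ U, a v ∈ U) → ∀ (m : ℕ), ∀ v ∈ U, (a ^ m) v ∈ U := by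
    intro a ha m
    induction m with
    | zero => simp
    | succ m ih => intro v hv; rw [pow_succ']; exact ha _ (ih v hv)
  have hwU : w ∈ U := hpow hfU n _ (hPU k u huU)
  obtain ⟨l, hl⟩ : ∃ l, P l w = w :=
    ⟨_, h.weight_f_pow (k := k) (by rw [← Module.End.mul_apply, h.P_mul, if_pos rfl]) n⟩
  have hefin : ∃ n : ℕ, (e ^ n) w = 0 := by
    obtain ⟨N, hN, -⟩ := h.upper_eq
    exact ⟨N, by rw [hN, LinearMap.zero_apply]⟩
  obtain ⟨m, hm⟩ : ∃ m, Nat.find hefin = m + 1 := by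
    refine Nat.exists_eq_succ_of_ne_zero fun h0 => ?_
    have := Nat.find_spec hefin
    rw [h0] at this
    exact hw0 (by simpa using this)
  have hem : (e ^ (m + 1)) w = 0 := hm ▸ Nat.find_spec hefin
  have hne : ∀ i ≤ m, (e ^ i) w ≠ 0 := fun i hi => Nat.find_min hefin (by omega)
  -- Applying f to e^(m+1) w = 0 yields -(m + 1)(l + m) e^m w = 0 with e^m w ≠ 0, which fixes the
  -- weight.
  have hlm : (l : ℂ) = -m := by
    have := h.f_e_pow_apply hl hfw m
    rw [hem, map_zero, eq_comm, smul_eq_zero] at this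
    have := this.resolve_right (hne m le_rfl)
    rw [mul_eq_zero] at this
    have := this.resolve_left (neg_ne_zero.2 (by exact_mod_cast m.succ_ne_zero))
    linear_combination this
  have hlm' : l = -m := by exact_mod_cast hlm
  subst hlm'
  have hind : LinearIndependent ℂ (fun i : Fin (m + 1) => (e ^ (i : ℕ)) w) := by
    rw [Fintype.linearIndependent_iff]
    intro c hc i
    have := congrArg (P (-m + 2 * ((i : ℕ) : ℤ))) hc
    rw [map_sum, map_zero, sum_eq_single_of_mem i (mem_univ _)] at this
    · rw [map_smul, h.weight_e_pow hl, smul_eq_zero] at this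
      exact this.resolve_right (hne i (by omega))
    · intro b _ hb
      rw [map_smul, h.weight_ne (h.weight_e_pow hl b), smul_zero]
      intro h'
      apply hb
      ext
      omega
  have hspan : Submodule.span ℂ (Set.range fun i : Fin (m + 1) => (e ^ (i : ℕ)) w) = U := by
    refine hirr _ ?_ (h.apply_mem_of_apply_mem ?_ ?_) ?_
    · rw [Submodule.span_le]
      rintro _ ⟨i, rfl⟩
      exact hpow heU _ _ hwU
    · intro v hv
      induction hv using Submodule.span_induction with
      | mem x hx =>
        obtain ⟨i, rfl⟩ := hx
        rw [← Module.End.mul_apply, ← pow_succ']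
        by_cases hi : (i : ℕ) + 1 ≤ m
        · exact Submodule.subset_span ⟨⟨i + 1, by omega⟩, rfl⟩
        · rw [show (i : ℕ) + 1 = m + 1 by omega, hem]
          exact zero_mem _
      | zero => simp
      | add x y _ _ hx hy => rw [map_add]; exact add_mem hx hy
      | smul c x _ hx => rw [map_smul]; exact Submodule.smul_mem _ _ hx
    · intro v hv
      induction hv using Submodule.span_induction with
      | mem x hx =>
        obtain ⟨⟨i, hi⟩, rfl⟩ := hx
        rcases i with _ | i
        · simp [hfw]
        · simp only
          rw [h.f_e_pow_apply hl hfw]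
          exact Submodule.smul_mem _ _ (Submodule.subset_span ⟨⟨i, by omega⟩, rfl⟩)
      | zero => simp
      | add x y _ _ hx hy => rw [map_add]; exact add_mem hx hy
      | smul c x _ hx => rw [map_smul]; exact Submodule.smul_mem _ _ hx
    · intro hbot
      have : w ∈ (⊥ : Submodule ℂ V) := hbot ▸ Submodule.subset_span ⟨0, by simp⟩
      exact hw0 (by simpa using this)
  have hmj : m = j := by
    have := finrank_span_eq_card hind
    rw [hspan, hdim, Fintype.card_fin] at this
    omega
  subst hmj
  exact ⟨w, hwU, hw0, hfw, hl, hem, hind, hspan⟩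

/-! ### Lowest weight functionals -/

/-- This is the dual of `f_e_pow_apply`: such an l is an extremal vector for the transposed
operators, and l ∘ f^n sees only the weight space of k + 2n, where the bracket acts by that scalar.
-/
theorem functional_f_pow_e {l : Dual ℂ V} {k : ℤ} (he : ∀ v, l (e v) = 0)
    (hk : ∀ v, l (P k v) = l v) (n : ℕ) (v : V) :
    l ((f ^ (n + 1)) (e v)) = (-((n : ℂ) + 1) * (k + n)) * l ((f ^ n) v) := by
  have hPf : ∀ (n : ℕ) (v : V), l ((f ^ n) (P (k + 2 * n) v)) = l ((f ^ n) v) := by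
    intro n
    induction n with
    | zero => simpa using hk
    | succ n ih =>
      intro v
      rw [pow_succ, Module.End.mul_apply, Module.End.mul_apply, ← ih (f v)]
      congr 2
      have := LinearMap.congr_fun (h.f_P (k + 2 * (n + 1 : ℕ))) v
      simp only [Module.End.mul_apply] at this
      rw [this]
      congr 2
      push_cast
      ring
  have key : ∀ (n : ℕ) (v : V),
      l ((f ^ n) (f (e v))) = l ((f ^ n) (e (f v))) - ((k : ℂ) + 2 * n) * l ((f ^ n) v) := by
    intro n v
    have h1 := LinearMap.congr_fun (h.e_P (k + 2 * n - 2)) (f v)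
    have h2 := LinearMap.congr_fun (h.f_P (k + 2 * n)) v
    have h3 := LinearMap.congr_fun (h.f_P (k + 2 * n + 2)) (e v)
    have h4 := LinearMap.congr_fun (h.e_P (k + 2 * n)) v
    have h5 := LinearMap.congr_fun (h.bracket (k + 2 * n)) v
    simp only [Module.End.mul_apply, LinearMap.sub_apply, LinearMap.smul_apply, sub_add_cancel,
      add_sub_cancel_right] at h1 h2 h3 h4 h5
    rw [h4, h3, h2, h1, sub_eq_iff_eq_add] at h5
    rw [← hPf n (e (f v)), h5, ← hPf n (f (e v)), map_add, map_add, map_smul, map_smul,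
      hPf n v]
    push_cast
    rw [smul_eq_mul]
    ring
  induction n generalizing v with
  | zero => simpa [he] using key 0 v
  | succ n ih =>
    rw [pow_succ, Module.End.mul_apply, key, ih, ← Module.End.mul_apply, ← pow_succ]
    push_cast
    ring

/-- The functional l ∘ f^(j+1) kills the range of e again, because the scalar in
`functional_f_pow_e` vanishes at n = j. It lives on weight j + 2, where the later scalars do not
vanish, so nilpotency of f forces it to be zero. -/
theorem functional_f_pow_eq_zero {l : Dual ℂ V} {j : ℕ} (he : ∀ v, l (e v) = 0)
    (hP : ∀ v, l (P (-j) v) = l v) (v : V) : l ((f ^ (j + 1)) v) = 0 := by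
  have hl' : ∀ v, (l ∘ₗ f ^ (j + 1)) (e v) = 0 := by
    intro v
    rw [LinearMap.comp_apply, h.functional_f_pow_e he hP]
    push_cast
    ring
  have hshift : ∀ (n : ℕ) (v : V), (f ^ n) (P (-j + 2 * n) v) = P (-j) ((f ^ n) v) := by
    intro n
    induction n with
    | zero => simp
    | succ n ih =>
      intro v
      have := LinearMap.congr_fun (h.f_P (-j + 2 * (n + 1 : ℕ))) v
      simp only [Module.End.mul_apply] at this
      rw [pow_succ, Module.End.mul_apply, Module.End.mul_apply, ← ih, this]
      congr 3
      push_cast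
      ring
  have hP' : ∀ v, (l ∘ₗ f ^ (j + 1)) (P (-j + 2 * (j + 1 : ℕ)) v) = (l ∘ₗ f ^ (j + 1)) v := by
    intro v
    rw [LinearMap.comp_apply, hshift, hP, LinearMap.comp_apply]
  set l' : Dual ℂ V := l ∘ₗ f ^ (j + 1) with hl'def
  have hdesc : ∀ n : ℕ, (∀ v, l' ((f ^ n) v) = 0) → ∀ v, l' v = 0 := by
    intro n
    induction n with
    | zero => exact fun h => by simpa using h
    | succ n ih =>
      intro hn
      refine ih fun v => ?_
      have := h.functional_f_pow_e hl' hP' n v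
      rw [hn, eq_comm, mul_eq_zero, mul_eq_zero] at this
      refine this.resolve_left ?_
      push Not
      refine ⟨neg_ne_zero.2 (by exact_mod_cast n.succ_ne_zero), ?_⟩
      have : ((-j + 2 * (j + 1 : ℕ) : ℤ) : ℂ) + n = ((j + 2 + n : ℕ) : ℂ) := by push_cast; ring
      rw [this]
      exact_mod_cast (by omega : j + 2 + n ≠ 0)
  obtain ⟨N, hN, -⟩ := h.lower_eq
  exact hdesc N (fun v => by rw [hN, LinearMap.zero_apply, map_zero]) v

end SL2Action

/-! ### Transvectants of lowest weight functionals -/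

/-- The functionals that vanish on the range of `e` and outside the weight space of `-j`. -/
def lowestFunctionals (e : End ℂ V) (P : ℤ → End ℂ V) (j : ℕ) : Submodule ℂ (Dual ℂ V) where
  carrier := {l | (∀ v, l (e v) = 0) ∧ ∀ v, l (P (-j) v) = l v}
  zero_mem' := by simp
  add_mem' := by
    rintro a b ⟨ha, ha'⟩ ⟨hb, hb'⟩
    exact ⟨fun v => by simp [ha, hb], fun v => by simp [ha', hb']⟩
  smul_mem' := by
    rintro c a ⟨ha, ha'⟩
    exact ⟨fun v => by simp [ha], fun v => by simp [ha']⟩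

/-- The lowest weight vectors of weight `-j`. -/
def lowestVectors (f : End ℂ V) (P : ℤ → End ℂ V) (j : ℕ) : Submodule ℂ V where
  carrier := {w | f w = 0 ∧ P (-j) w = w}
  zero_mem' := by simp
  add_mem' := by
    rintro a b ⟨ha, ha'⟩ ⟨hb, hb'⟩
    exact ⟨by simp [ha, hb], by simp [ha', hb']⟩
  smul_mem' := by
    rintro c a ⟨ha, ha'⟩
    exact ⟨by simp [ha], by simp [ha']⟩

/-- The bilinear form `∑ (-1)ᵏ l(fᵏ v) l'(fʲ⁻ᵏ w)`. -/
def transvectant (f : End ℂ V) (j : ℕ) (l l' : Dual ℂ V) : V →ₗ[ℂ] V →ₗ[ℂ] ℂ :=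
  ∑ k ∈ range (j + 1), ((-1 : ℂ) ^ k) •
    (LinearMap.mul ℂ ℂ).compl₁₂ (l ∘ₗ f ^ k) (l' ∘ₗ f ^ (j - k))

theorem transvectant_apply (f : End ℂ V) (j : ℕ) (l l' : Dual ℂ V) (v w : V) :
    transvectant f j l l' v w =
      ∑ k ∈ range (j + 1), (-1) ^ k * (l ((f ^ k) v) * l' ((f ^ (j - k)) w)) := by
  simp [transvectant, LinearMap.sum_apply]

namespace SL2Action

variable (h : SL2Action R e f P)

include h

/-- The alternating sum telescopes. The two end terms contain l ∘ f^(j+1) or l' ∘ f^(j+1), which are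
zero. -/
theorem transvectant_f {j : ℕ} {l l' : Dual ℂ V} (hl : l ∈ lowestFunctionals e P j)
    (hl' : l' ∈ lowestFunctionals e P j) (v w : V) :
    transvectant f j l l' (f v) w = -transvectant f j l l' v (f w) := by
  rw [eq_neg_iff_add_eq_zero, transvectant_apply, transvectant_apply, sum_range_succ,
    sum_range_succ' _ j]
  have h1 : l ((f ^ j) (f v)) = 0 := by
    rw [← Module.End.mul_apply, ← pow_succ]
    exact h.functional_f_pow_eq_zero hl.1 hl.2 v
  have h2 : l' ((f ^ (j - 0)) (f w)) = 0 := by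
    rw [← Module.End.mul_apply, ← pow_succ]
    exact h.functional_f_pow_eq_zero hl'.1 hl'.2 w
  rw [h1, h2]
  simp only [zero_mul, mul_zero, add_zero]
  rw [← sum_add_distrib]
  refine sum_eq_zero fun k hk => ?_
  have hk : k < j := by simpa using hk
  rw [← Module.End.mul_apply, ← Module.End.mul_apply, ← pow_succ, ← pow_succ,
    show j - (k + 1) + 1 = j - k by omega]
  ring

/-- Moving e past f^(k+1) and past f^(j-k) produces the same scalar (k + 1)(j - k), so signs alone,
without binomial coefficients, make the terms cancel. -/
theorem transvectant_e {j : ℕ} {l l' : Dual ℂ V} (hl : l ∈ lowestFunctionals e P j)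
    (hl' : l' ∈ lowestFunctionals e P j) (v w : V) :
    transvectant f j l l' (e v) w = -transvectant f j l l' v (e w) := by
  rw [eq_neg_iff_add_eq_zero, transvectant_apply, transvectant_apply, sum_range_succ' _ j,
    sum_range_succ _ j]
  have h1 : l ((f ^ 0) (e v)) = 0 := by simpa using hl.1 v
  have h2 : l' ((f ^ (j - j)) (e w)) = 0 := by simpa using hl'.1 w
  rw [h1, h2]
  simp only [zero_mul, mul_zero, add_zero]
  rw [← sum_add_distrib]
  refine sum_eq_zero fun k hk => ?_
  have hk : k < j := by simpa using hk
  obtain ⟨i, rfl⟩ : ∃ i, j = k + 1 + i := ⟨j - (k + 1), by omega⟩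
  rw [show k + 1 + i - (k + 1) = i by omega, show k + 1 + i - k = i + 1 by omega,
    h.functional_f_pow_e hl.1 hl.2, h.functional_f_pow_e hl'.1 hl'.2]
  push_cast
  ring

theorem transvectant_invariant {j : ℕ} {l l' : Dual ℂ V} (hl : l ∈ lowestFunctionals e P j)
    (hl' : l' ∈ lowestFunctionals e P j) (g : SL(2, ℂ)) :
    ∀ v w, transvectant f j l l' (R g v) (R g w) = transvectant f j l l' v w := by
  induction g using unipotent_induction with
  | hu t =>
    exact h.upper_eq.bilin_invariant (fun s t => by rw [upper_add, map_mul])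
      (by rw [upper_zero, map_one]) _ (h.transvectant_e hl hl') t
  | hl t =>
    exact h.lower_eq.bilin_invariant (fun s t => by rw [lower_add, map_mul])
      (by rw [lower_zero, map_one]) _ (h.transvectant_f hl hl') t
  | hmul a b ha hb =>
    intro v w
    rw [map_mul, Module.End.mul_apply, Module.End.mul_apply, ha, hb]

/-- Every functional on the lowest weight vectors extends to a lowest weight functional. -/
theorem exists_extension {j : ℕ} (m : Dual ℂ (lowestVectors f P j)) :
    ∃ l ∈ lowestFunctionals e P j, ∀ w : lowestVectors f P j, l w = m w := by
  let q := (LinearMap.range e).mkQ ∘ₗ (lowestVectors f P j).subtype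
  have hq : LinearMap.ker q = ⊥ := by
    rw [LinearMap.ker_eq_bot']
    rintro ⟨w, hw⟩ hqw
    obtain ⟨x, hx⟩ : w ∈ LinearMap.range e := by simpa [q] using hqw
    simpa using h.lowest_notMem_range hw.2 hw.1 hx
  obtain ⟨r, hr⟩ := q.exists_leftInverse_of_injective hq
  -- The lowest weight vectors embed into V / e V by `lowest_notMem_range`, and r is a retraction of
  -- this embedding. Projecting to weight -j beforehand gives the second condition.
  refine ⟨m ∘ₗ r ∘ₗ (LinearMap.range e).mkQ ∘ₗ P (-j), ⟨fun v => ?_, fun v => ?_⟩, fun w => ?_⟩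
  · have h1 := LinearMap.congr_fun (h.e_P (-j - 2)) v
    simp only [Module.End.mul_apply, sub_add_cancel] at h1
    have h2 : (LinearMap.range e).mkQ (P (-j) (e v)) = 0 := by
      rw [← h1, Submodule.mkQ_apply, Submodule.Quotient.mk_eq_zero]
      exact ⟨_, rfl⟩
    simp only [LinearMap.comp_apply, h2, map_zero]
  · simp only [LinearMap.comp_apply]
    rw [← Module.End.mul_apply, h.P_mul, if_pos rfl]
  · have := LinearMap.congr_fun hr w
    simp only [LinearMap.comp_apply, w.2.2]
    exact congrArg m this

/-- The scalar by which `fʲ eʲ` acts on lowest weight vectors of weight `-j`. -/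
theorem exists_scalar (j : ℕ) :
    ∃ c : ℂ, c ≠ 0 ∧ ∀ w ∈ lowestVectors f P j, (f ^ j) ((e ^ j) w) = c • w := by
  refine ⟨_, ?_, fun w hw => h.f_pow_e_pow_apply hw.2 hw.1 j⟩
  refine prod_ne_zero_iff.2 fun i hi => ?_
  have hi : i < j := by simpa using hi
  refine mul_ne_zero (neg_ne_zero.2 (by exact_mod_cast i.succ_ne_zero)) ?_
  push_cast
  rw [neg_add_eq_sub, sub_ne_zero]
  exact_mod_cast hi.ne

omit h in
theorem transvectant_lowest {j : ℕ} {l l' : Dual ℂ V} {c : ℂ} {w : V}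
    (hw : w ∈ lowestVectors f P j) (hc : (f ^ j) ((e ^ j) w) = c • w) :
    transvectant f j l l' w ((e ^ j) w) = c * (l w * l' w) := by
  rw [transvectant_apply, sum_eq_single_of_mem 0 (by simp)]
  · simp [hc]
    ring
  · intro k _ hk
    obtain ⟨k, rfl⟩ := Nat.exists_eq_succ_of_ne_zero hk
    rw [pow_succ f, Module.End.mul_apply, hw.1]
    simp

/-- For 0 < k < j the vector f^k (w + e^j w) has weight j - 2k ≠ -j and is invisible to l. The terms
k = 0 and k = j are c l(w) l'(w) and (-1)^j c l(w) l'(w), which cancel for odd j. -/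
theorem transvectant_diagonal {j : ℕ} (hj : Odd j) {l l' : Dual ℂ V} {c : ℂ} {w : V}
    (hl : l ∈ lowestFunctionals e P j) (hl' : l' ∈ lowestFunctionals e P j)
    (hw : w ∈ lowestVectors f P j) (hc : (f ^ j) ((e ^ j) w) = c • w) :
    transvectant f j l l' (w + (e ^ j) w) (w + (e ^ j) w) = 0 := by
  have hval : ∀ l ∈ lowestFunctionals e P j, ∀ k : ℕ, k ≠ 0 → k ≠ j →
      l ((f ^ k) (w + (e ^ j) w)) = 0 := by
    intro l hl k hk hkj
    obtain ⟨i, rfl⟩ := Nat.exists_eq_succ_of_ne_zero hk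
    have h1 : (f ^ (i + 1)) w = 0 := by
      rw [pow_succ, Module.End.mul_apply, hw.1, map_zero]
    rw [map_add, h1, zero_add, ← hl.2,
      h.weight_ne (h.weight_f_pow (h.weight_e_pow hw.2 j) (i + 1)), map_zero]
    push_cast
    omega
  obtain ⟨i, rfl⟩ : ∃ i, j = i + 1 := ⟨j - 1, by have := hj.pos; omega⟩
  have h0 : ∀ l ∈ lowestFunctionals e P (i + 1), l (w + (e ^ (i + 1)) w) = l w := by
    intro l hl
    rw [map_add, pow_succ' e, Module.End.mul_apply, hl.1, add_zero]
  have h1 : ∀ l : Dual ℂ V, l ((f ^ (i + 1)) (w + (e ^ (i + 1)) w)) = c * l w := by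
    intro l
    rw [map_add, hc, pow_succ f, Module.End.mul_apply, hw.1]
    simp
  rw [transvectant_apply, sum_range_succ, sum_range_succ', sum_eq_zero]
  · rw [Nat.sub_zero, Nat.sub_self, pow_zero f, Module.End.one_apply, h0 l hl, h0 l' hl', h1, h1,
      hj.neg_one_pow]
    ring
  · intro k hk
    have hk : k < i := by simpa using hk
    rw [hval l hl (k + 1) (by omega) (by omega)]
    simp

end SL2Action

end SL2

namespace SL2

open Finset Module

/-! ### Automorphisms of `SL₂` -/

theorem isPolynomialRep_of_coeff {V : Type*} [AddCommGroup V] [Module ℂ V] [FiniteDimensional ℂ V]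
    {R : Representation ℂ SL(2, ℂ) V}
    (h : ∀ (l : Dual ℂ V) (v : V), ∃ p : MvPolynomial (Fin 2 × Fin 2) ℂ, ∀ g : SL(2, ℂ),
      l (R g v) = MvPolynomial.eval (fun ij => (g : Matrix (Fin 2) (Fin 2) ℂ) ij.1 ij.2) p) :
    IsPolynomialRep R := by
  intro l
  let b := Module.finBasis ℂ V
  choose p hp using fun i k => h (b.coord i) (b k)
  refine ⟨∑ i, ∑ k, MvPolynomial.C (l (Matrix.toLin b b (Matrix.single i k 1))) * p i k,
    fun g => ?_⟩
  have h1 : R g = ∑ i, ∑ k, (b.coord i (R g (b k))) • Matrix.toLin b b (Matrix.single i k 1) := by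
    conv_lhs => rw [← Matrix.toLin_toMatrix b b (R g),
      Matrix.matrix_eq_sum_single (LinearMap.toMatrix b b (R g))]
    simp only [map_sum, ← map_smul, Matrix.smul_single, smul_eq_mul, mul_one,
      LinearMap.toMatrix_apply, Basis.coord_apply]
  conv_lhs => rw [h1]
  simp only [map_sum, map_smul, smul_eq_mul, map_mul, MvPolynomial.eval_C, hp]
  exact sum_congr rfl fun i _ => sum_congr rfl fun k _ => mul_comm _ _

/-- The representation of `SL₂` on `ℂ²` through an endomorphism of `SL₂`. -/
def twistedStandard (σ : SL(2, ℂ) →* SL(2, ℂ)) : Representation ℂ SL(2, ℂ) (Fin 2 → ℂ) where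
  toFun g := Matrix.toLin' (σ g : Matrix (Fin 2) (Fin 2) ℂ)
  map_one' := by simp [Module.End.one_eq_id]
  map_mul' a b := by
    rw [map_mul, Matrix.SpecialLinearGroup.coe_mul, Matrix.toLin'_mul]
    rfl

theorem twistedStandard_apply (σ : SL(2, ℂ) →* SL(2, ℂ)) (g : SL(2, ℂ)) (v : Fin 2 → ℂ) :
    twistedStandard σ g v = (σ g : Matrix (Fin 2) (Fin 2) ℂ).mulVec v := rfl

/-- The standard representation of `SL₂` is irreducible. -/
theorem eq_top_of_stable {U : Submodule ℂ (Fin 2 → ℂ)}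
    (hU : ∀ g : SL(2, ℂ), ∀ v ∈ U, (g : Matrix (Fin 2) (Fin 2) ℂ).mulVec v ∈ U) (hne : U ≠ ⊥) :
    U = ⊤ := by
  obtain ⟨u, hu, hu0⟩ := U.ne_bot_iff.1 hne
  have hup : ∀ v ∈ U, ![v 1, 0] ∈ U := fun v hv => by
    convert U.sub_mem (hU (upper 1) v hv) hv using 1
    ext i
    fin_cases i <;> simp [dotProduct, Fin.sum_univ_two]
  have hlow : ∀ v ∈ U, ![0, v 0] ∈ U := fun v hv => by
    convert U.sub_mem (hU (lower 1) v hv) hv using 1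
    ext i
    fin_cases i <;> simp [dotProduct, Fin.sum_univ_two]
  obtain ⟨c, hc, hcU⟩ : ∃ c : ℂ, c ≠ 0 ∧ ![c, 0] ∈ U := by
    by_cases h1 : u 1 = 0
    · have h0 : u 0 ≠ 0 := by
        intro h0
        apply hu0
        ext i
        fin_cases i <;> simp [h0, h1]
      exact ⟨u 0, h0, by simpa using hup _ (hlow u hu)⟩
    · exact ⟨u 1, h1, hup u hu⟩
  have hcU' : ![0, c] ∈ U := by simpa using hlow _ hcU
  rw [eq_top_iff]
  intro v _
  convert U.add_mem (U.smul_mem (v 0 / c) hcU) (U.smul_mem (v 1 / c) hcU') using 1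
  ext i
  fin_cases i <;> simp [hc]

theorem IsExpOf.apply_eq {V : Type*} [AddCommGroup V] [Module ℂ V] {F : ℂ → End ℂ V}
    {a : End ℂ V} (h : IsExpOf F a) {v : V} (hv : a (a v) = 0) (t : ℂ) :
    F t v = v + t • a v := by
  obtain ⟨N, hN, -, hF⟩ := h.of_le 2
  obtain ⟨M, rfl⟩ : ∃ M, N = M + 2 := ⟨N - 2, by omega⟩
  rw [hF, LinearMap.sum_apply, sum_range_succ', sum_range_succ', sum_eq_zero]
  · simp [add_comm]
  · intro k _
    rw [LinearMap.smul_apply, pow_succ a, pow_succ a, Module.End.mul_apply, Module.End.mul_apply, hv,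
      map_zero, smul_zero]

/-- Algebraic automorphisms of `SL₂` are inner. -/
theorem exists_conj (σ : SL(2, ℂ) →* SL(2, ℂ)) (hσ : Function.Surjective σ)
    (hpoly : ∀ i k, ∃ p : MvPolynomial (Fin 2 × Fin 2) ℂ, ∀ g : SL(2, ℂ),
      (σ g : Matrix (Fin 2) (Fin 2) ℂ) i k =
        MvPolynomial.eval (fun ij => (g : Matrix (Fin 2) (Fin 2) ℂ) ij.1 ij.2) p) :
    ∃ a : SL(2, ℂ), ∀ x, σ x = a * x * a⁻¹ := by
  choose p hp using hpoly
  have hR : IsPolynomialRep (twistedStandard σ) := by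
    refine isPolynomialRep_of_coeff fun l v => ?_
    refine ⟨∑ i, ∑ k, MvPolynomial.C (l (Pi.single i 1) * v k) * p i k, fun g => ?_⟩
    have h1 : twistedStandard σ g v = ∑ i, (∑ k, (σ g : Matrix (Fin 2) (Fin 2) ℂ) i k * v k) •
        (Pi.single i 1 : Fin 2 → ℂ) := by
      rw [twistedStandard_apply]
      ext i
      simp [Matrix.mulVec, dotProduct, Finset.sum_apply, Pi.single_apply]
    rw [h1]
    simp only [map_sum, map_smul, smul_eq_mul, map_mul, MvPolynomial.eval_C, ← hp, sum_mul]
    exact sum_congr rfl fun i _ => sum_congr rfl fun k _ => by ring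
  obtain ⟨e, f, P, h⟩ := hR.exists_action
  obtain ⟨w, -, -, hfw, hw, hew, hind, -⟩ := h.exists_lowest (U := ⊤) (by simp)
    (fun U' _ hU' hne => eq_top_of_stable (fun g v hv => by
      obtain ⟨x, rfl⟩ := hσ g
      exact hU' x v hv) hne) (j := 1) (by simp)
  have hfe : f (e w) = w := by
    have := h.f_e_pow_apply hw hfw 0
    simpa using this
  have hee : e (e w) = 0 := by simpa [pow_two] using hew
  -- The columns are the highest and the lowest weight vector of the twisted representation, so `B`
  -- intertwines it with the standard one.
  let B : Matrix (Fin 2) (Fin 2) ℂ := Matrix.of fun i k => ![e w i, w i] k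
  have hB : B.det ≠ 0 := by
    intro hdet
    rw [Matrix.det_fin_two] at hdet
    rw [Fintype.linearIndependent_iff] at hind
    simp [B] at hdet
    have h0 := hind ![(e w) 0, - w 0] (by
      ext i
      fin_cases i
      · simp [Fin.sum_univ_two]; ring
      · simp [Fin.sum_univ_two]; linear_combination hdet)
    have h1 := hind ![(e w) 1, - w 1] (by
      ext i
      fin_cases i
      · simp [Fin.sum_univ_two]; linear_combination -hdet
      · simp [Fin.sum_univ_two]; ring)
    have hw0 : w = 0 := by
      ext i
      fin_cases i
      · simpa using h0 1
      · simpa using h1 1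
    have := hind ![1, 0] (by simp [hw0]) 0
    simp at this
  have hmul : ∀ (x : SL(2, ℂ)) (y z : Fin 2 → ℂ), twistedStandard σ x (e w) = y →
      twistedStandard σ x w = z → (σ x : Matrix (Fin 2) (Fin 2) ℂ) * B =
        Matrix.of fun i k => ![y i, z i] k := by
    rintro x y z rfl rfl
    ext i k
    fin_cases k <;>
      simp [B, Matrix.mul_apply, twistedStandard_apply, Matrix.mulVec, dotProduct]
  have hinter : ∀ x : SL(2, ℂ), (σ x : Matrix (Fin 2) (Fin 2) ℂ) * B = B * x := by
    intro x
    induction x using unipotent_induction with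
    | hu t =>
      rw [hmul _ _ _ (h.upper_eq.apply_eq (by rw [hee, map_zero]) t) (h.upper_eq.apply_eq hee t)]
      ext i k
      fin_cases k <;> simp [B, Matrix.mul_apply, Fin.sum_univ_two, hee]
      ring
    | hl t =>
      rw [hmul _ _ _ (h.lower_eq.apply_eq (by rw [hfe, hfw]) t)
        (h.lower_eq.apply_eq (by rw [hfw, map_zero]) t)]
      ext i k
      fin_cases k <;> simp [B, Matrix.mul_apply, Fin.sum_univ_two, hfe, hfw]
      ring
    | hmul a b ha hb =>
      rw [map_mul, Matrix.SpecialLinearGroup.coe_mul, Matrix.SpecialLinearGroup.coe_mul, mul_assoc,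
        hb, ← mul_assoc, ha, mul_assoc]
  -- Dividing by a square root of the determinant moves `B` into SL₂ without changing conjugation by
  -- it.
  obtain ⟨c, hc⟩ := IsAlgClosed.exists_pow_nat_eq B.det (n := 2) two_pos
  have hc0 : c ≠ 0 := by
    rintro rfl
    exact hB (by rw [← hc]; simp)
  let a : SL(2, ℂ) := ⟨c⁻¹ • B, by
    rw [Matrix.det_smul, Fintype.card_fin, ← hc, ← mul_pow, inv_mul_cancel₀ hc0, one_pow]⟩
  refine ⟨a, fun x => ?_⟩
  rw [eq_mul_inv_iff_mul_eq]
  apply Subtype.ext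
  rw [Matrix.SpecialLinearGroup.coe_mul, Matrix.SpecialLinearGroup.coe_mul]
  simp only [a, Matrix.mul_smul, Matrix.smul_mul, hinter]

/-- The center of `SL₂`. -/
theorem eq_one_or_neg_one {x : SL(2, ℂ)} (hx : ∀ y, x * y = y * x) : x = 1 ∨ x = -1 := by
  have hdet : x.1 0 0 * x.1 1 1 - x.1 0 1 * x.1 1 0 = 1 := by
    rw [← Matrix.det_fin_two]; exact x.2
  have hu := congrArg Subtype.val (hx (upper 1))
  have hl := congrArg Subtype.val (hx (lower 1))
  rw [Matrix.SpecialLinearGroup.coe_mul, Matrix.SpecialLinearGroup.coe_mul] at hu hl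
  have h1 := congrFun (congrFun hu 0) 0
  have h2 := congrFun (congrFun hu 0) 1
  have h3 := congrFun (congrFun hl 0) 0
  simp [Matrix.mul_apply, Fin.sum_univ_two] at h1 h2 h3
  have h4 : x.1 0 0 = x.1 1 1 := by linear_combination h2
  rw [h3, h1, ← h4] at hdet
  have h5 : (x.1 0 0 - 1) * (x.1 0 0 + 1) = 0 := by linear_combination hdet
  rcases mul_eq_zero.1 h5 with h6 | h6
  · left
    ext i k
    fin_cases i <;> fin_cases k <;> simp [h1, h3, ← h4] <;> linear_combination h6
  · right
    ext i k
    fin_cases i <;> fin_cases k <;> simp [h1, h3, ← h4] <;> linear_combination h6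

end SL2

namespace SL2

open Finset Module

/-! ### Zariski topology on `GL n ℂ` -/

/-- A map between general linear groups whose entries are polynomial is Zariski continuous. -/
theorem continuous_zariski_of_polynomial {m n : ℕ} (T : GL (Fin m) ℂ → GL (Fin n) ℂ)
    (q : Fin n × Fin n → MvPolynomial (Fin m × Fin m) ℂ)
    (hq : ∀ g ij, (T g : Matrix (Fin n) (Fin n) ℂ) ij.1 ij.2 =
      MvPolynomial.eval (fun ij => (g : Matrix (Fin m) (Fin m) ℂ) ij.1 ij.2) (q ij)) :
    Continuous[zariskiTopology m, zariskiTopology n] T := by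
  let _ := zariskiTopology m
  let _ := zariskiTopology n
  refine continuous_def.2 fun O hO => ?_
  obtain ⟨S, hS⟩ : ∃ S, Oᶜ = glZeroLocus S := hO
  refine show ∃ S, (T ⁻¹' O)ᶜ = glZeroLocus S from ⟨MvPolynomial.bind₁ q '' S, ?_⟩
  rw [← Set.preimage_compl, hS]
  have key : ∀ (p : MvPolynomial (Fin n × Fin n) ℂ) (g : GL (Fin m) ℂ),
      MvPolynomial.eval (fun ij => (g : Matrix (Fin m) (Fin m) ℂ) ij.1 ij.2)
        (MvPolynomial.bind₁ q p) =
      MvPolynomial.eval (fun ij => (T g : Matrix (Fin n) (Fin n) ℂ) ij.1 ij.2) p := by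
    intro p g
    rw [← MvPolynomial.coe_aeval_eq_eval, RingHom.coe_coe, MvPolynomial.aeval_bind₁,
      ← MvPolynomial.coe_aeval_eq_eval, RingHom.coe_coe]
    congr 2
    ext ij
    rw [hq]
    rfl
  ext g
  simp only [Set.mem_preimage, glZeroLocus, Set.mem_ofPred_eq, Set.forall_mem_image, key]

theorem continuous_zariski_mul_right {n : ℕ} (a : GL (Fin n) ℂ) :
    Continuous[zariskiTopology n, zariskiTopology n] (fun g => g * a) :=
  continuous_zariski_of_polynomial _
    (fun ij => ∑ k, MvPolynomial.X (ij.1, k) *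
      MvPolynomial.C ((a : Matrix (Fin n) (Fin n) ℂ) k ij.2)) fun g ij => by
    simp [Matrix.mul_apply]

/-- The identity component is a normal subgroup. -/
theorem conj_mem_identityComponent {n : ℕ} {G : Subgroup (GL (Fin n) ℂ)} {g h : GL (Fin n) ℂ}
    (hg : g ∈ G) (hh : h ∈ identityComponent G) : g * h * g⁻¹ ∈ identityComponent G := by
  let _ := zariskiTopology n
  have hcont : Continuous fun x : GL (Fin n) ℂ => g * x * g⁻¹ :=
    (continuous_zariski_mul_right g⁻¹).comp (continuous_zariski_mul_left g)
  refine (isPreconnected_connectedComponentIn.image (fun x => g * x * g⁻¹)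
    hcont.continuousOn).subset_connectedComponentIn
      ⟨1, (identityComponent G).one_mem, by simp⟩ ?_ ⟨h, hh, rfl⟩
  rintro _ ⟨x, hx, rfl⟩
  exact G.mul_mem (G.mul_mem hg (connectedComponentIn_subset _ _ hx)) (G.inv_mem hg)

/-- Sending g to the kernel of evaluation at g shows that the topology is induced from the spectrum
of a Noetherian ring. -/
theorem noetherianSpace_zariski (n : ℕ) :
    @TopologicalSpace.NoetherianSpace (GL (Fin n) ℂ) (zariskiTopology n) := by
  let _ := zariskiTopology n
  let pt : GL (Fin n) ℂ → PrimeSpectrum (MvPolynomial (Fin n × Fin n) ℂ) := fun g =>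
    ⟨RingHom.ker (MvPolynomial.eval fun ij => (g : Matrix (Fin n) (Fin n) ℂ) ij.1 ij.2),
      RingHom.ker_isPrime _⟩
  have hclosed : ∀ Z : Set (GL (Fin n) ℂ), IsClosed Z ↔ ∃ S, Z = glZeroLocus S := by
    intro Z
    rw [← isOpen_compl_iff]
    conv_rhs => rw [← compl_compl Z]
    exact Iff.rfl
  have hpre : ∀ S : Set (MvPolynomial (Fin n × Fin n) ℂ),
      pt ⁻¹' PrimeSpectrum.zeroLocus S = glZeroLocus S := by
    intro S
    ext g
    exact Iff.rfl
  have hind : Topology.IsInducing pt := by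
    refine ⟨TopologicalSpace.ext_iff_isClosed.2 fun Z => ?_⟩
    rw [hclosed, isClosed_induced_iff]
    constructor
    · rintro ⟨S, rfl⟩
      exact ⟨_, PrimeSpectrum.isClosed_zeroLocus S, hpre S⟩
    · rintro ⟨K, hK, rfl⟩
      obtain ⟨S, rfl⟩ := (PrimeSpectrum.isClosed_iff_zeroLocus K).1 hK
      exact ⟨S, hpre S⟩
  exact hind.noetherianSpace

/-- The identity component has finite index. -/
theorem finiteIndex_identityComponent {n : ℕ} (G : Subgroup (GL (Fin n) ℂ)) :
    ((identityComponent G).subgroupOf G).FiniteIndex := by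
  let _ := zariskiTopology n
  have := noetherianSpace_zariski n
  have : TopologicalSpace.NoetherianSpace G := Topology.IsInducing.subtypeVal.noetherianSpace
  have hfin : Finite (irreducibleComponents G) :=
    (TopologicalSpace.NoetherianSpace.finite_irreducibleComponents (α := G)).to_subtype
  have : Finite (G ⧸ (identityComponent G).subgroupOf G) := by
    -- Each coset is sent to an irreducible component through a representative. If a and b share a
    -- component, its translate by a⁻¹ is connected and contains 1 and a⁻¹ b, so the cosets agree.
    refine Finite.of_injective (β := irreducibleComponents G)
      (fun q => ⟨irreducibleComponent q.out, irreducibleComponent_mem_irreducibleComponents _⟩)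
      fun a b hab => ?_
    have hab : irreducibleComponent a.out = irreducibleComponent b.out := congrArg Subtype.val hab
    rw [← a.out_eq', ← b.out_eq', QuotientGroup.eq]
    change ((a.out⁻¹ * b.out : G) : GL (Fin n) ℂ) ∈ identityComponent G
    have hpre : IsPreconnected ((fun x : G => ((a.out : G) : GL (Fin n) ℂ)⁻¹ * x) ''
        irreducibleComponent a.out) :=
      isIrreducible_irreducibleComponent.isPreirreducible.isPreconnected.image _
        ((continuous_zariski_mul_left _).comp continuous_subtype_val).continuousOn
    refine hpre.subset_connectedComponentIn ⟨a.out, mem_irreducibleComponent, inv_mul_cancel _⟩ ?_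
      ⟨b.out, hab ▸ mem_irreducibleComponent, rfl⟩
    rintro _ ⟨x, -, rfl⟩
    exact G.mul_mem (G.inv_mem a.out.2) x.2
  exact Subgroup.finiteIndex_of_finite_quotient

/-! ### Regular functions -/

theorem entry_mem_regularFunctions {n : ℕ} (G : Subgroup (GL (Fin n) ℂ)) (i k : Fin n) :
    (fun g : G => ((g : GL (Fin n) ℂ) : Matrix (Fin n) (Fin n) ℂ) i k) ∈ regularFunctions G :=
  Algebra.subset_adjoin (Or.inl ⟨i, k, rfl⟩)

theorem inv_det_mem_regularFunctions {n : ℕ} (G : Subgroup (GL (Fin n) ℂ)) :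
    (fun g : G => (((g : GL (Fin n) ℂ) : Matrix (Fin n) (Fin n) ℂ).det)⁻¹) ∈ regularFunctions G :=
  Algebra.subset_adjoin (Or.inr rfl)

/-- Pulling back regular functions along a map that pulls back the generators to regular
functions. -/
theorem comp_mem_regularFunctions {m n : ℕ} {H : Subgroup (GL (Fin m) ℂ)}
    {K : Subgroup (GL (Fin n) ℂ)} (T : H → K)
    (hentry : ∀ i k, (fun h => ((T h : GL (Fin n) ℂ) : Matrix (Fin n) (Fin n) ℂ) i k) ∈
      regularFunctions H)
    (hdet : (fun h => (((T h : GL (Fin n) ℂ) : Matrix (Fin n) (Fin n) ℂ).det)⁻¹) ∈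
      regularFunctions H) {F : K → ℂ} (hF : F ∈ regularFunctions K) :
    (fun h => F (T h)) ∈ regularFunctions H := by
  induction hF using Algebra.adjoin_induction with
  | mem F hF =>
    rcases hF with ⟨i, k, rfl⟩ | rfl
    · exact hentry i k
    · exact hdet
  | algebraMap r => exact algebraMap_mem (regularFunctions H) r
  | add a b _ _ ha hb => exact add_mem ha hb
  | mul a b _ _ ha hb => exact mul_mem ha hb

/-- `SL₂(ℂ)` as a linear algebraic group. -/
def toAlgSL2 : SL(2, ℂ) →* algSL2 := Matrix.SpecialLinearGroup.toGL.rangeRestrict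

theorem coe_toAlgSL2 (g : SL(2, ℂ)) :
    ((toAlgSL2 g : GL (Fin 2) ℂ) : Matrix (Fin 2) (Fin 2) ℂ) = g := rfl

theorem regularFunctions_algSL2 {F : algSL2 → ℂ} (hF : F ∈ regularFunctions algSL2) :
    ∃ p : MvPolynomial (Fin 2 × Fin 2) ℂ, ∀ g : SL(2, ℂ),
      F (toAlgSL2 g) =
        MvPolynomial.eval (fun ij => (g : Matrix (Fin 2) (Fin 2) ℂ) ij.1 ij.2) p := by
  induction hF using Algebra.adjoin_induction with
  | mem F hF =>
    rcases hF with ⟨i, k, rfl⟩ | rfl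
    · exact ⟨MvPolynomial.X (i, k), fun g => by simp [coe_toAlgSL2]⟩
    · exact ⟨1, fun g => by simp [coe_toAlgSL2]⟩
  | algebraMap r => exact ⟨MvPolynomial.C r, fun g => by rw [MvPolynomial.eval_C]; rfl⟩
  | add a b _ _ ha hb =>
    obtain ⟨p, hp⟩ := ha
    obtain ⟨q, hq⟩ := hb
    exact ⟨p + q, fun g => by rw [Pi.add_apply, hp, hq, map_add]⟩
  | mul a b _ _ ha hb =>
    obtain ⟨p, hp⟩ := ha
    obtain ⟨q, hq⟩ := hb
    exact ⟨p * q, fun g => by rw [Pi.mul_apply, hp, hq, map_mul]⟩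

/-! ### Splitting off the finite centralizer -/

/-- A group whose identity component is `SL₂` is the product of `SL₂` and a finite group that
centralizes it. -/
theorem exists_decomposition {n : ℕ} {G : Subgroup (GL (Fin n) ℂ)}
    (hG0 : AlgGroupIsomorphic (identityComponent G) algSL2) :
    ∃ (ι : SL(2, ℂ) →* G) (C : Subgroup G), Finite C ∧ ι (-1) ∈ C ∧ (∀ c ∈ C, ∀ x, c * ι x = ι x * c) ∧
      (∀ g, ∃ c ∈ C, ∃ x, g = ι x * c) ∧ ι.range = (identityComponent G).subgroupOf G ∧
      ∀ F ∈ regularFunctions G, ∃ p : MvPolynomial (Fin 2 × Fin 2) ℂ, ∀ g : SL(2, ℂ),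
        F (ι g) = MvPolynomial.eval (fun ij => (g : Matrix (Fin 2) (Fin 2) ℂ) ij.1 ij.2) p := by
  obtain ⟨φ, hφ, hφ'⟩ := hG0
  have hsurj : Function.Surjective toAlgSL2 := MonoidHom.rangeRestrict_surjective _
  have hinj : Function.Injective toAlgSL2 := by
    intro a b hab
    apply Subtype.ext
    rw [← coe_toAlgSL2, ← coe_toAlgSL2, hab]
  let e : SL(2, ℂ) ≃* algSL2 := MulEquiv.ofBijective toAlgSL2 ⟨hinj, hsurj⟩
  let ψ : SL(2, ℂ) ≃* identityComponent G := e.trans φ.symm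
  let inc : identityComponent G →* G := Subgroup.inclusion (identityComponent_le G)
  let ι : SL(2, ℂ) →* G := inc.comp ψ.toMonoidHom
  have hιinj : Function.Injective ι :=
    (Subgroup.inclusion_injective (identityComponent_le G)).comp ψ.injective
  have hrange : ι.range = (identityComponent G).subgroupOf G := by
    ext g
    rw [Subgroup.mem_subgroupOf]
    constructor
    · rintro ⟨x, rfl⟩
      exact (ψ x).2
    · intro hg
      refine ⟨ψ.symm ⟨g, hg⟩, ?_⟩
      apply Subtype.ext
      change ((ψ (ψ.symm ⟨g, hg⟩) : identityComponent G) : GL (Fin n) ℂ) = g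
      rw [ψ.apply_symm_apply]
  have hregG0 : ∀ F ∈ regularFunctions (identityComponent G),
      ∃ p : MvPolynomial (Fin 2 × Fin 2) ℂ, ∀ g : SL(2, ℂ),
        F (ψ g) = MvPolynomial.eval (fun ij => (g : Matrix (Fin 2) (Fin 2) ℂ) ij.1 ij.2) p :=
    fun F hF => regularFunctions_algSL2 (hφ' F hF)
  let C : Subgroup G := Subgroup.centralizer (ι.range : Set G)
  have hC : ∀ c ∈ C, ∀ x, c * ι x = ι x * c := fun c hc x =>
    (Subgroup.mem_centralizer_iff.1 hc (ι x) ⟨x, rfl⟩).symm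
  -- The intersection of C with the image of SL₂ lies in the image of the center {1, -1}, and it has
  -- finite index in C.
  have hfin : Finite C := by
    have := finiteIndex_identityComponent G
    rw [← hrange] at this
    have hN : Finite (ι.range.subgroupOf C) := by
      have : Finite ({ι 1, ι (-1)} : Set G) := Set.toFinite _
      refine Finite.of_injective (β := ({ι 1, ι (-1)} : Set G)) (fun x => ⟨x.1.1, ?_⟩) ?_
      · obtain ⟨y, hy⟩ := x.2
        have hy : ι y = x.1.1 := hy
        rw [← hy]
        have : y = 1 ∨ y = -1 := eq_one_or_neg_one fun z => hιinj (by
          rw [map_mul, map_mul, hy]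
          exact hC _ x.1.2 z)
        rcases this with rfl | rfl <;> simp
      · intro a b hab
        have h1 := Subtype.ext_iff.1 hab
        exact Subtype.ext (Subtype.ext h1)
    refine Nat.finite_of_card_ne_zero ?_
    rw [← Subgroup.card_mul_index (ι.range.subgroupOf C)]
    exact mul_ne_zero Nat.card_pos.ne' Subgroup.FiniteIndex.index_ne_zero
  have hneg : ι (-1) ∈ C := by
    refine Subgroup.mem_centralizer_iff.2 ?_
    rintro _ ⟨x, rfl⟩
    rw [← map_mul, ← map_mul, mul_neg_one, neg_one_mul]
  refine ⟨ι, C, hfin, hneg, hC, fun g => ?_, hrange, fun F hF => ?_⟩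
  · let cj : identityComponent G →* identityComponent G :=
      { toFun := fun h => ⟨(g : GL (Fin n) ℂ) * h * (g : GL (Fin n) ℂ)⁻¹,
          conj_mem_identityComponent g.2 h.2⟩
        map_one' := by simp
        map_mul' := fun a b => by
          apply Subtype.ext
          simp }
    have hcj : ∀ x, inc (cj x) = g * inc x * g⁻¹ := fun x => rfl
    let σ : SL(2, ℂ) →* SL(2, ℂ) := ψ.symm.toMonoidHom.comp (cj.comp ψ.toMonoidHom)
    have hψσ : ∀ x, ψ (σ x) = cj (ψ x) := fun x => ψ.apply_symm_apply _
    have hισ : ∀ x, ι (σ x) = g * ι x * g⁻¹ := fun x => by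
      change inc (ψ (σ x)) = g * inc (ψ x) * g⁻¹
      rw [hψσ, hcj]
    have hσ : Function.Surjective σ := by
      intro y
      let z : identityComponent G := ⟨(g : GL (Fin n) ℂ)⁻¹ * (ψ y) * g, by
        simpa using conj_mem_identityComponent (G.inv_mem g.2) (ψ y).2⟩
      refine ⟨ψ.symm z, ψ.injective ?_⟩
      rw [hψσ, ψ.apply_symm_apply]
      apply Subtype.ext
      change (g : GL (Fin n) ℂ) * ((g : GL (Fin n) ℂ)⁻¹ * (ψ y) * g) * (g : GL (Fin n) ℂ)⁻¹ = ψ y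
      group
    obtain ⟨a, ha⟩ := exists_conj σ hσ fun i k => by
      have h1 := hφ _ (entry_mem_regularFunctions algSL2 i k)
      have h2 := comp_mem_regularFunctions (K := identityComponent G) cj (fun i k => ?_) ?_ h1
      · obtain ⟨p, hp⟩ := hregG0 _ h2
        refine ⟨p, fun x => ?_⟩
        rw [← hp x]
        have h3 : φ (cj (ψ x)) = e (σ x) := by
          rw [← hψσ]
          exact φ.apply_symm_apply _
        rw [h3]
        rfl
      · have h4 : (fun h : identityComponent G =>
            ((cj h : GL (Fin n) ℂ) : Matrix (Fin n) (Fin n) ℂ) i k) =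
            ∑ r, ∑ s, ((((g : GL (Fin n) ℂ) : Matrix (Fin n) (Fin n) ℂ) i r) *
              (((g : GL (Fin n) ℂ)⁻¹ : GL (Fin n) ℂ) : Matrix (Fin n) (Fin n) ℂ) s k) •
              fun h : identityComponent G => ((h : GL (Fin n) ℂ) : Matrix (Fin n) (Fin n) ℂ) r s := by
          funext h
          change (((g : GL (Fin n) ℂ) * h * (g : GL (Fin n) ℂ)⁻¹ : GL (Fin n) ℂ) :
            Matrix (Fin n) (Fin n) ℂ) i k = _
          rw [Units.val_mul, Units.val_mul, Matrix.mul_apply]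
          simp only [Matrix.mul_apply, Finset.sum_apply, Pi.smul_apply, smul_eq_mul, sum_mul]
          rw [sum_comm]
          exact sum_congr rfl fun r _ => sum_congr rfl fun s _ => by ring
        rw [h4]
        exact sum_mem fun r _ => sum_mem fun s _ =>
          Subalgebra.smul_mem _ (entry_mem_regularFunctions _ r s) _
      · convert inv_det_mem_regularFunctions (identityComponent G) using 2 with h
        change (((g : GL (Fin n) ℂ) * h * (g : GL (Fin n) ℂ)⁻¹ : GL (Fin n) ℂ) :
            Matrix (Fin n) (Fin n) ℂ).det⁻¹ = _
        rw [Units.val_mul, Units.val_mul, Matrix.det_mul, Matrix.det_mul, mul_right_comm,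
          ← Matrix.det_mul, ← Units.val_mul, mul_inv_cancel]
        simp
    -- Conjugation by g agrees on SL₂ with conjugation by a, so (ι a)⁻¹ g centralizes it.
    refine ⟨(ι a)⁻¹ * g, ?_, a, by group⟩
    refine Subgroup.mem_centralizer_iff.2 ?_
    rintro _ ⟨x, rfl⟩
    have h5 := hισ x
    rw [ha, map_mul, map_mul, map_inv, eq_mul_inv_iff_mul_eq] at h5
    rw [mul_assoc, ← h5]
    group
  · refine hregG0 (fun h => F (inc h)) (comp_mem_regularFunctions inc (fun i k => ?_) ?_ hF)
    · exact entry_mem_regularFunctions (identityComponent G) i k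
    · exact inv_det_mem_regularFunctions (identityComponent G)

end SL2

namespace SL2

open Finset Module

/-! ### Restricting polarizations to a pair of lines -/

theorem linearIndependent_monomial (n : ℕ) :
    LinearIndependent ℂ (fun (α : Fin n → ℕ) (s : Fin n → ℂ) => ∏ i, s i ^ α i) := by
  let χ : (Fin n → ℕ) → ((Fin n → ℂ) →* ℂ) := fun α =>
    { toFun := fun s => ∏ i, s i ^ α i
      map_one' := by simp
      map_mul' := fun s t => by simp [mul_pow, prod_mul_distrib] }
  refine (linearIndependent_monoidHom (Fin n → ℂ) ℂ).comp χ fun α β h => ?_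
  funext i
  have h1 : ∏ k, (Function.update 1 i 2 : Fin n → ℂ) k ^ α k =
      ∏ k, (Function.update 1 i 2 : Fin n → ℂ) k ^ β k :=
    DFunLike.congr_fun h (Function.update (1 : Fin n → ℂ) i 2)
  have h2 : ∀ γ : Fin n → ℕ, ∏ k, (Function.update 1 i 2 : Fin n → ℂ) k ^ γ k = 2 ^ γ i := by
    intro γ
    rw [prod_eq_single_of_mem i (mem_univ _)]
    · simp
    · intro k _ hk
      simp [Function.update_of_ne hk]
  rw [h2, h2] at h1
  exact Nat.pow_right_injective le_rfl (by exact_mod_cast h1)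

section Coefficients

open MvPolynomial

variable {σ : Type*} {d : ℕ}

/-- The coefficients in the lowest positive degree of a product of polynomials. -/
theorem coeff_mul_of_lowest {A A' : MvPolynomial σ ℂ}
    (hA : ∀ α : σ →₀ ℕ, α ≠ 0 → α.degree < d → coeff α A = 0)
    {α : σ →₀ ℕ} (hα : α ≠ 0)
    (hd : α.degree ≤ d) :
    coeff α (A * A') = coeff 0 A * coeff α A' + coeff α A * coeff 0 A' := by
  classical
  rw [coeff_mul]
  refine sum_eq_add_of_mem (0, α) (α, 0) (by simp) (by simp)
    (fun h => hα (congrArg Prod.snd h)) ?_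
  rintro ⟨β, γ⟩ hβγ ⟨h1, h2⟩
  rw [HasAntidiagonal.mem_antidiagonal] at hβγ
  simp only at hβγ
  have hβ : β ≠ 0 := by
    rintro rfl
    exact h1 (by rw [← hβγ, zero_add])
  have hγ : γ ≠ 0 := by
    rintro rfl
    exact h2 (by rw [← hβγ, add_zero])
  have hdeg : β.degree + γ.degree = α.degree := by rw [← hβγ, map_add]
  have hγpos : γ.degree ≠ 0 := by rwa [Ne, Finsupp.degree_eq_zero_iff]
  rw [hA β hβ (by omega), zero_mul]

end Coefficients

variable {V : Type*} [AddCommGroup V] [Module ℂ V]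

theorem polarization_apply_smul {k d : ℕ} {f : V → ℂ}
    {F : (Fin k → ℕ) → (Fin k → V) → ℂ} (hF : IsPolarizationFamily k d f F) {α : Fin k → ℕ}
    (hα : α ∈ piAntidiag univ d) (t : Fin k → ℂ) (v : Fin k → V) :
    F α (fun i => t i • v i) = (∏ i, t i ^ α i) * F α v := by
  refine coeff_eq_of_sum_eq (linearIndependent_monomial k) (piAntidiag univ d)
    (fun α => F α (fun i => t i • v i)) (fun α => (∏ i, t i ^ α i) * F α v) (fun s => ?_) α hα
  have h1 := hF s (fun i => t i • v i)
  have h2 := hF (fun i => s i * t i) v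
  simp only [smul_smul] at h1
  simp only [smul_eq_mul]
  rw [← h1, h2]
  refine sum_congr rfl fun β _ => ?_
  simp only [mul_pow, prod_mul_distrib]
  ring

/-- Polarizations have the coefficients that the polarized function has along given vectors. -/
theorem polarization_eq_of_expansion {k d : ℕ} {f : V → ℂ}
    {F : (Fin k → ℕ) → (Fin k → V) → ℂ} (hF : IsPolarizationFamily k d f F) {α : Fin k → ℕ}
    (hα : α ∈ piAntidiag univ d) (v : Fin k → V) (c : (Fin k → ℕ) → ℂ)
    (hc : ∀ s : Fin k → ℂ, f (∑ i, s i • v i) =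
      ∑ α ∈ piAntidiag univ d, (∏ i, s i ^ α i) * c α) : F α v = c α := by
  refine coeff_eq_of_sum_eq (linearIndependent_monomial k) (piAntidiag univ d)
    (fun α => F α v) c (fun s => ?_) α hα
  simp only [smul_eq_mul]
  rw [← hF s v, hc s]

/-- The exponent `(m, m)`. -/
noncomputable def diagExponent (m : ℕ) : Fin 2 →₀ ℕ := Finsupp.equivFunOnFinite.symm fun _ => m

theorem degree_equivFunOnFinite_symm {n : ℕ} (α : Fin n → ℕ) :
    (Finsupp.equivFunOnFinite.symm α).degree = ∑ i, α i := by
  rw [Finsupp.degree_eq_sum]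
  rfl

theorem eval_monomial_fin {n : ℕ} (α : Fin n → ℕ) (c : ℂ) (t : Fin n → ℂ) :
    MvPolynomial.eval t (MvPolynomial.monomial (Finsupp.equivFunOnFinite.symm α) c) =
      (∏ i, t i ^ α i) * c := by
  rw [MvPolynomial.eval_monomial, Finsupp.prod_fintype _ _ (by simp), mul_comm]
  rfl

/-- The functions on `2V` whose restrictions to `(ℂ w, ℂ y)` and `(ℂ (w + y), ℂ (w + y))` are
polynomials that, up to degree `2 m`, have the same constant terms, no other terms of degree less
than `2 m`, and proportional terms of bidegree `(m, m)`. -/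
def compatibleFunctions (w y : V) (m : ℕ) (hm : 0 < m) : Subalgebra ℂ ((Fin 2 → V) → ℂ) where
  carrier := {p | ∃ A B : MvPolynomial (Fin 2) ℂ,
    (∀ t, MvPolynomial.eval t A = p (fun i => t i • ![w, y] i)) ∧
    (∀ t, MvPolynomial.eval t B = p (fun i => t i • (w + y))) ∧
    MvPolynomial.coeff 0 A = MvPolynomial.coeff 0 B ∧
    (∀ α : Fin 2 →₀ ℕ, α ≠ 0 → α.degree < 2 * m → MvPolynomial.coeff α A = 0) ∧
    (∀ α : Fin 2 →₀ ℕ, α ≠ 0 → α.degree < 2 * m → MvPolynomial.coeff α B = 0) ∧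
    MvPolynomial.coeff (diagExponent m) B =
      Nat.multinomial univ (fun _ : Fin 2 => m) * MvPolynomial.coeff (diagExponent m) A}
  algebraMap_mem' c := by
    refine ⟨MvPolynomial.C c, MvPolynomial.C c, fun t => by simp,
      fun t => by simp, rfl, fun α hα _ => ?_, fun α hα _ => ?_,
      ?_⟩
    · rw [MvPolynomial.coeff_C, if_neg hα.symm]
    · rw [MvPolynomial.coeff_C, if_neg hα.symm]
    · have : (0 : Fin 2 →₀ ℕ) ≠ diagExponent m := fun h => hm.ne (DFunLike.congr_fun h 0)
      rw [MvPolynomial.coeff_C, if_neg this, mul_zero]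
  add_mem' := by
    rintro p q ⟨A, B, hA, hB, h0, hA0, hB0, hAB⟩ ⟨A', B', hA', hB', h0', hA0', hB0', hAB'⟩
    refine ⟨A + A', B + B', fun t => ?_, fun t => ?_, ?_, fun α h1 h2 => ?_, fun α h1 h2 => ?_, ?_⟩
    · rw [map_add, hA, hA', Pi.add_apply]
    · rw [map_add, hB, hB', Pi.add_apply]
    · rw [MvPolynomial.coeff_add, MvPolynomial.coeff_add, h0, h0']
    · rw [MvPolynomial.coeff_add, hA0 α h1 h2, hA0' α h1 h2, add_zero]
    · rw [MvPolynomial.coeff_add, hB0 α h1 h2, hB0' α h1 h2, add_zero]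
    · rw [MvPolynomial.coeff_add, MvPolynomial.coeff_add, hAB, hAB', mul_add]
  mul_mem' := by
    rintro p q ⟨A, B, hA, hB, h0, hA0, hB0, hAB⟩ ⟨A', B', hA', hB', h0', hA0', hB0', hAB'⟩
    refine ⟨A * A', B * B', fun t => ?_, fun t => ?_, ?_, fun α h1 h2 => ?_, fun α h1 h2 => ?_, ?_⟩
    · rw [map_mul, hA, hA', Pi.mul_apply]
    · rw [map_mul, hB, hB', Pi.mul_apply]
    · rw [MvPolynomial.coeff_mul, MvPolynomial.coeff_mul]
      simp [h0, h0']
    · rw [coeff_mul_of_lowest hA0 h1 h2.le, hA0 α h1 h2, hA0' α h1 h2]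
      simp
    · rw [coeff_mul_of_lowest hB0 h1 h2.le, hB0 α h1 h2, hB0' α h1 h2]
      simp
    · have h1 : diagExponent m ≠ 0 := fun h => hm.ne' (DFunLike.congr_fun h 0)
      have h2 : (diagExponent m).degree ≤ 2 * m := by
        rw [diagExponent, degree_equivFunOnFinite_symm]
        simp
      -- In degree 2m only constant term times top term survives, so equal constant terms preserve
      -- the proportionality.
      rw [coeff_mul_of_lowest hA0 h1 h2, coeff_mul_of_lowest hB0 h1 h2, hAB, hAB', h0,
        h0']
      ring

/-- It suffices to treat a generator. A polarization is multihomogeneous, so both restrictions are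
monomials of the same exponent, whose coefficients are read off from f on the plane spanned by w and
y. The hypotheses `hlow` and `htorus` describe f there. -/
theorem polarizationAlgebra_le_compatibleFunctions {G : Type*} [Group G]
    {ρ : Representation ℂ G V} {w y : V} {m : ℕ} (hm : 0 < m)
    (hlow : ∀ F ∈ invariantPolynomials ρ, ∀ k, IsHomogeneousFunction F k → 0 < k → k < 2 * m →
      ∀ a b : ℂ, F (a • w + b • y) = 0)
    (htorus : ∀ F ∈ invariantPolynomials ρ, IsHomogeneousFunction F (2 * m) →
      ∀ a b : ℂ, F (a • w + b • y) = (a * b) ^ m * F (w + y)) :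
    polarizationAlgebra ρ 2 ≤ compatibleFunctions w y m hm := by
  refine Algebra.adjoin_le ?_
  rintro _ ⟨f, hf, k, hfk, F, hF, α, hα, rfl⟩
  have hsum : ∑ i, α i = k := (mem_piAntidiag.1 hα).1
  have hdeg := degree_equivFunOnFinite_symm α
  rw [hsum] at hdeg
  refine ⟨MvPolynomial.monomial (Finsupp.equivFunOnFinite.symm α) (F α ![w, y]),
    MvPolynomial.monomial (Finsupp.equivFunOnFinite.symm α) (F α fun _ => w + y),
    fun t => ?_, fun t => ?_, ?_, ?_, ?_, ?_⟩
  · rw [eval_monomial_fin, polarization_apply_smul hF hα]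
  · rw [eval_monomial_fin, polarization_apply_smul hF hα t fun _ => w + y]
  · rw [MvPolynomial.coeff_monomial, MvPolynomial.coeff_monomial]
    split_ifs with h0
    · rw [h0, map_zero] at hdeg
      subst hdeg
      have hconst : ∀ v : Fin 2 → V, F α v = f 0 := by
        intro v
        refine polarization_eq_of_expansion hF hα v (fun _ => f 0) fun s => ?_
        have h1 := hfk 0 (∑ i, s i • v i)
        rw [zero_smul, pow_zero, one_mul] at h1
        rw [← h1]
        simp
      rw [hconst, hconst]
    · rfl
  · intro β hβ hβd
    rw [MvPolynomial.coeff_monomial]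
    split_ifs with h0
    · have hk : β.degree = k := by rw [← h0, hdeg]
      have hk0 : 0 < k := by
        rw [← hk, Nat.pos_iff_ne_zero, Ne, Finsupp.degree_eq_zero_iff]
        exact hβ
      refine polarization_eq_of_expansion hF hα _ (fun _ => 0) fun s => ?_
      simpa [Fin.sum_univ_two] using hlow f hf k hfk hk0 (by omega) (s 0) (s 1)
    · rfl
  · intro β hβ hβd
    rw [MvPolynomial.coeff_monomial]
    split_ifs with h0
    · have hk : β.degree = k := by rw [← h0, hdeg]
      have hk0 : 0 < k := by
        rw [← hk, Nat.pos_iff_ne_zero, Ne, Finsupp.degree_eq_zero_iff]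
        exact hβ
      refine polarization_eq_of_expansion hF hα _ (fun _ => 0) fun s => ?_
      rw [← sum_smul, smul_add, hlow f hf k hfk hk0 (by omega)]
      simp
    · rfl
  · rw [MvPolynomial.coeff_monomial, MvPolynomial.coeff_monomial]
    split_ifs with h0
    · have hαm : α = fun _ => m := Finsupp.equivFunOnFinite.symm.injective h0
      have hk : k = 2 * m := by rw [← hsum, hαm]; simp
      subst hk
      have h1 : F α ![w, y] = f (w + y) := by
        have := polarization_eq_of_expansion hF hα ![w, y] (fun β => if β = α then f (w + y) else 0)
          fun s => by
            rw [sum_eq_single_of_mem α hα]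
            · have := htorus f hf hfk (s 0) (s 1)
              simp only [Fin.sum_univ_two, Matrix.cons_val_zero, Matrix.cons_val_one, this, hαm,
                Fin.prod_univ_two, if_true, mul_pow]
            · intro β _ hβ
              rw [if_neg hβ, mul_zero]
        simpa using this
      -- With both arguments equal to w + y, f contributes (s₀ + s₁)^(2m) f(w + y), whence the
      -- multinomial coefficient.
      have h2 := polarization_eq_of_expansion hF hα (fun _ => w + y)
        (fun β => Nat.multinomial univ β * f (w + y)) fun s => by
          rw [← sum_smul, hfk, sum_pow_eq_sum_piAntidiag, sum_mul]
          exact sum_congr rfl fun β _ => by ring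
      rw [h1, h2, hαm]
    · simp

end SL2

namespace SL2

open Finset Module

/-! ### Homogeneous polynomial functions -/

section Homogeneous

variable {X Y : Type*} [AddCommGroup X] [Module ℂ X] [AddCommGroup Y] [Module ℂ Y]

/-- The linear functions on `X`. -/
def linearFunctions (X : Type*) [AddCommGroup X] [Module ℂ X] : Submodule ℂ (X → ℂ) where
  carrier := {f | ∃ l : Dual ℂ X, f = fun v => l v}
  zero_mem' := ⟨0, rfl⟩
  add_mem' := by
    rintro _ _ ⟨a, rfl⟩ ⟨b, rfl⟩
    exact ⟨a + b, rfl⟩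
  smul_mem' := by
    rintro c _ ⟨a, rfl⟩
    exact ⟨c • a, rfl⟩

/-- Composition with a map as a homomorphism of algebras of functions. -/
def pullback (T : X → Y) : (Y → ℂ) →ₐ[ℂ] (X → ℂ) where
  toFun F x := F (T x)
  map_one' := rfl
  map_mul' _ _ := rfl
  map_zero' := rfl
  map_add' _ _ := rfl
  commutes' _ := rfl

theorem pullback_mem_pow (T : X →ₗ[ℂ] Y) {k : ℕ} {F : Y → ℂ} (hF : F ∈ linearFunctions Y ^ k) :
    pullback T F ∈ linearFunctions X ^ k := by
  have h1 : (linearFunctions Y).map (pullback T).toLinearMap ≤ linearFunctions X := by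
    rintro _ ⟨_, ⟨l, rfl⟩, rfl⟩
    exact ⟨l ∘ₗ T, rfl⟩
  have h2 := Submodule.mem_map_of_mem (f := (pullback T).toLinearMap) hF
  rw [Submodule.map_pow] at h2
  exact pow_le_pow_left' h1 k h2

theorem apply_smul_of_mem_pow {k : ℕ} {F : X → ℂ} (hF : F ∈ linearFunctions X ^ k) (c : ℂ) (x : X) :
    F (c • x) = c ^ k * F x := by
  induction hF using Submodule.pow_induction_on_left' with
  | algebraMap r => simp
  | add F F' k _ _ h h' => rw [Pi.add_apply, h, h', Pi.add_apply, mul_add]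
  | mem_mul l hl k F _ h =>
    obtain ⟨l, rfl⟩ := hl
    rw [Pi.mul_apply, h, Pi.mul_apply, map_smul, smul_eq_mul, pow_succ]
    ring

theorem polyFunctions_le_iSup {F : X → ℂ} (hF : F ∈ polyFunctions X) :
    F ∈ ⨆ k : ℕ, linearFunctions X ^ k := by
  induction hF using Algebra.adjoin_induction with
  | mem F hF => exact Submodule.mem_iSup_of_mem 1 (by rw [pow_one]; exact hF)
  | algebraMap r =>
    refine Submodule.mem_iSup_of_mem 0 ?_
    rw [pow_zero]
    exact Submodule.algebraMap_mem r
  | add a b _ _ ha hb => exact add_mem ha hb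
  | mul a b _ _ ha hb =>
    have h1 := Submodule.mul_mem_mul ha hb
    simp_rw [Submodule.iSup_mul, Submodule.mul_iSup, ← pow_add] at h1
    refine (iSup_le fun i => iSup_le fun k => ?_ : _ ≤ ⨆ k : ℕ, linearFunctions X ^ k) h1
    exact le_iSup (fun k : ℕ => linearFunctions X ^ k) (i + k)

/-- A homogeneous polynomial function of degree `d` is a combination of products of `d` linear
functions. -/
theorem mem_pow_of_isHomogeneous {F : X → ℂ} (hF : F ∈ polyFunctions X) {d : ℕ}
    (hd : IsHomogeneousFunction F d) : F ∈ linearFunctions X ^ d := by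
  obtain ⟨E, hE, rfl⟩ := (Submodule.mem_iSup_iff_exists_finsupp _ _).1 (polyFunctions_le_iSup hF)
  -- Evaluating at c x and comparing powers of c isolates the component of degree d.
  have key : E.sum (fun _ x => x) = E d := by
    funext x
    have := coeff_eq_of_sum_eq linearIndependent_pow (insert d E.support) (fun k => E k x)
      (fun k => if k = d then E.sum (fun _ x => x) x else 0) (fun c => by
        have h1 := hd c x
        simp only [smul_ite, smul_zero, sum_ite_eq', mem_insert_self, if_true]
        rw [smul_eq_mul (c ^ d), ← h1, Finsupp.sum, Finset.sum_apply]
        rw [← sum_subset (subset_insert d E.support)]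
        · exact sum_congr rfl fun k _ => (apply_smul_of_mem_pow (hE k) c x).symm
        · intro k _ hk
          simp [Finsupp.notMem_support_iff.1 hk]) d (mem_insert_self _ _)
    rw [if_pos rfl] at this
    exact this.symm
  rw [key]
  exact hE d

theorem prod_mem_pow {ι : Type*} (s : Finset ι) (F : ι → X → ℂ)
    (hF : ∀ i ∈ s, F i ∈ linearFunctions X) : ∏ i ∈ s, F i ∈ linearFunctions X ^ s.card := by
  classical
  induction s using Finset.induction_on with
  | empty => simp [Submodule.one_le.1 le_rfl]
  | insert a s ha ih =>
    rw [prod_insert ha, card_insert_of_notMem ha, pow_succ']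
    exact Submodule.mul_mem_mul (hF a (mem_insert_self _ _))
      (ih fun i hi => hF i (mem_insert_of_mem hi))

theorem pullback_mem_polyFunctions (T : X →ₗ[ℂ] Y) {F : Y → ℂ} (hF : F ∈ polyFunctions Y) :
    pullback T F ∈ polyFunctions X := by
  induction hF using Algebra.adjoin_induction with
  | mem F hF =>
    obtain ⟨l, rfl⟩ := hF
    exact Algebra.subset_adjoin ⟨l ∘ₗ T, rfl⟩
  | algebraMap r => exact algebraMap_mem (polyFunctions X) r
  | add a b _ _ ha hb => rw [map_add]; exact add_mem ha hb
  | mul a b _ _ ha hb => rw [map_mul]; exact mul_mem ha hb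

end Homogeneous

variable {V : Type*} [AddCommGroup V] [Module ℂ V]

/-! ### Invariants of two copies from transvectants -/

/-- The space spanned by the transvectants of lowest weight functionals, as functions on `2V`. -/
def transvectantSpace (e f : End ℂ V) (P : ℤ → End ℂ V) (j : ℕ) :
    Submodule ℂ ((Fin 2 → V) → ℂ) :=
  Submodule.span ℂ {F | ∃ l ∈ lowestFunctionals e P j, ∃ l' ∈ lowestFunctionals e P j,
    F = fun v => transvectant f j l l' (v 0) (v 1)}

section Transvectants

variable {R : Representation ℂ SL(2, ℂ) V} {e f : End ℂ V} {P : ℤ → End ℂ V}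

theorem transvectantSpace_le_polyFunctions (j : ℕ) :
    transvectantSpace e f P j ≤ (polyFunctions (Fin 2 → V)).toSubmodule := by
  refine Submodule.span_le.2 ?_
  rintro _ ⟨l, -, l', -, rfl⟩
  have h1 : (fun v : Fin 2 → V => transvectant f j l l' (v 0) (v 1)) =
      ∑ k ∈ range (j + 1), ((-1 : ℂ) ^ k) •
        ((fun v : Fin 2 → V => (l ∘ₗ (f ^ k) ∘ₗ LinearMap.proj 0) v) *
          fun v : Fin 2 → V => (l' ∘ₗ (f ^ (j - k)) ∘ₗ LinearMap.proj 1) v) := by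
    funext v
    rw [transvectant_apply, Finset.sum_apply]
    rfl
  rw [h1]
  have h2 : ∀ l : Dual ℂ (Fin 2 → V), (fun v => l v) ∈ polyFunctions (Fin 2 → V) :=
    fun l => Algebra.subset_adjoin ⟨l, rfl⟩
  exact sum_mem fun k _ => Subalgebra.smul_mem _ (mul_mem (h2 _) (h2 _)) _

theorem polyFunctions_of_mem_pow {j m : ℕ} {F : (Fin 2 → V) → ℂ}
    (hF : F ∈ transvectantSpace e f P j ^ m) : F ∈ polyFunctions (Fin 2 → V) := by
  induction hF using Submodule.pow_induction_on_left' with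
  | algebraMap r => exact algebraMap_mem _ r
  | add F F' k _ _ h h' => exact add_mem h h'
  | mem_mul l hl k F _ h => exact mul_mem (transvectantSpace_le_polyFunctions j hl) h

theorem bihomogeneous_of_mem_pow {j m : ℕ} {F : (Fin 2 → V) → ℂ}
    (hF : F ∈ transvectantSpace e f P j ^ m) (t : Fin 2 → ℂ) (v : Fin 2 → V) :
    F (fun i => t i • v i) = (t 0 * t 1) ^ m * F v := by
  have h1 : ∀ F ∈ transvectantSpace e f P j, F (fun i => t i • v i) = (t 0 * t 1) * F v := by
    intro F hF
    induction hF using Submodule.span_induction with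
    | mem F hF =>
      obtain ⟨l, -, l', -, rfl⟩ := hF
      simp only [map_smul, LinearMap.smul_apply, smul_eq_mul]
      ring
    | zero => simp
    | add F F' _ _ h h' => rw [Pi.add_apply, h, h', Pi.add_apply, mul_add]
    | smul c F _ h =>
      rw [Pi.smul_apply, h, Pi.smul_apply, smul_eq_mul, smul_eq_mul]
      ring
  induction hF using Submodule.pow_induction_on_left' with
  | algebraMap r => simp
  | add F F' k _ _ h h' => rw [Pi.add_apply, h, h', Pi.add_apply, mul_add]
  | mem_mul l hl k F _ h =>
    rw [Pi.mul_apply, h, h1 l hl, Pi.mul_apply, pow_succ]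
    ring

theorem SL2Action.invariant_of_mem_pow (h : SL2Action R e f P) {j m : ℕ} {F : (Fin 2 → V) → ℂ}
    (hF : F ∈ transvectantSpace e f P j ^ m) (g : SL(2, ℂ)) (v : Fin 2 → V) :
    F (fun i => R g (v i)) = F v := by
  have h1 : ∀ F ∈ transvectantSpace e f P j, F (fun i => R g (v i)) = F v := by
    intro F hF
    induction hF using Submodule.span_induction with
    | mem F hF =>
      obtain ⟨l, hl, l', hl', rfl⟩ := hF
      exact h.transvectant_invariant hl hl' g _ _
    | zero => simp
    | add F F' _ _ h h' => rw [Pi.add_apply, h, h', Pi.add_apply]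
    | smul c F _ h => rw [Pi.smul_apply, h, Pi.smul_apply]
  induction hF using Submodule.pow_induction_on_left' with
  | algebraMap r => simp
  | add F F' k _ _ h h' => rw [Pi.add_apply, h, h', Pi.add_apply]
  | mem_mul l hl k F _ h => rw [Pi.mul_apply, h, h1 l hl, Pi.mul_apply]

theorem SL2Action.diagonal_of_mem_pow (h : SL2Action R e f P) {j m : ℕ} (hj : Odd j) (hm : 0 < m)
    {F : (Fin 2 → V) → ℂ} (hF : F ∈ transvectantSpace e f P j ^ m) {w : V}
    (hw : w ∈ lowestVectors f P j) : F (fun _ => w + (e ^ j) w) = 0 := by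
  obtain ⟨c, -, hc⟩ := h.exists_scalar j
  have h1 : ∀ F ∈ transvectantSpace e f P j, F (fun _ => w + (e ^ j) w) = 0 := by
    intro F hF
    induction hF using Submodule.span_induction with
    | mem F hF =>
      obtain ⟨l, hl, l', hl', rfl⟩ := hF
      exact h.transvectant_diagonal hj hl hl' hw (hc w hw)
    | zero => simp
    | add F F' _ _ h h' => rw [Pi.add_apply, h, h', add_zero]
    | smul c F _ h => rw [Pi.smul_apply, h, smul_zero]
  obtain ⟨m, rfl⟩ := Nat.exists_eq_succ_of_ne_zero hm.ne'
  rw [Nat.succ_eq_add_one, pow_succ] at hF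
  induction hF using Submodule.mul_induction_on' with
  | mem_mul_mem a _ b hb => rw [Pi.mul_apply, h1 b hb, mul_zero]
  | add a _ b _ ha hb => rw [Pi.add_apply, ha, hb, add_zero]

/-- Every polynomial function of degree `2 m` on the lowest weight vectors comes from an
`SL₂`-invariant on `2V`. -/
theorem SL2Action.exists_lift (h : SL2Action R e f P) {j m : ℕ}
    {ψ : lowestVectors f P j → ℂ} (hψ : ψ ∈ linearFunctions (lowestVectors f P j) ^ (2 * m)) :
    ∃ F ∈ transvectantSpace e f P j ^ m, ∀ w : lowestVectors f P j,
      F ![(w : V), (e ^ j) w] = ψ w := by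
  obtain ⟨c, hc0, hc⟩ := h.exists_scalar j
  let res := pullback (X := lowestVectors f P j) (Y := Fin 2 → V)
    fun w => ![(w : V), (e ^ j) (w : V)]
  -- Every product of two functionals on W is the restriction of a transvectant divided by c. Taking
  -- m-th powers of submodules then covers degree 2m.
  have h1 : linearFunctions (lowestVectors f P j) ^ 2 ≤
      (transvectantSpace e f P j).map res.toLinearMap := by
    rw [pow_two, Submodule.mul_le]
    rintro _ ⟨a, rfl⟩ _ ⟨b, rfl⟩
    obtain ⟨l, hl, hla⟩ := h.exists_extension a
    obtain ⟨l', hl', hlb⟩ := h.exists_extension b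
    refine ⟨c⁻¹ • fun v => transvectant f j l l' (v 0) (v 1),
      Submodule.smul_mem _ _ (Submodule.subset_span ⟨l, hl, l', hl', rfl⟩), ?_⟩
    funext w
    change c⁻¹ * transvectant f j l l' (w : V) ((e ^ j) (w : V)) = a w * b w
    rw [transvectant_lowest w.2 (hc w w.2), hla, hlb, inv_mul_cancel_left₀ hc0]
  rw [pow_mul] at hψ
  have h2 := pow_le_pow_left' h1 m hψ
  rw [← Submodule.map_pow] at h2
  obtain ⟨F, hF, hFψ⟩ := h2
  exact ⟨F, hF, fun w => congrFun hFψ w⟩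

end Transvectants

/-! ### The invariant of two copies that is not a polarization -/

/-- A module of a product of `SL₂` and a finite group with a lowest weight vector of odd weight does
not have the 2-polarization property. -/
theorem not_hasPolarizationProperty {G : Type*} [Group G] (ρ : Representation ℂ G V)
    (ι : SL(2, ℂ) →* G) (C : Subgroup G) [Finite C] (hneg : ι (-1) ∈ C)
    (hC : ∀ c ∈ C, ∀ x, c * ι x = ι x * c) (hG : ∀ g, ∃ c ∈ C, ∃ x, g = ι x * c)
    {e f : End ℂ V} {P : ℤ → End ℂ V} (h : SL2Action (ρ.comp ι) e f P) {j : ℕ} (hj : Odd j)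
    {w₀ : V} (hw₀ : w₀ ∈ lowestVectors f P j) (hw₀' : w₀ ≠ 0) : ¬ HasPolarizationProperty ρ 2 := by
  classical
  have := Fintype.ofFinite C
  let W := lowestVectors f P j
  have hcomm : ∀ (c : C) (x : End ℂ V), x ∈ Submodule.span ℂ (Set.range (ρ.comp ι)) →
      ∀ v, ρ c (x v) = x (ρ c v) := by
    intro c x hx v
    refine LinearMap.congr_fun (commute_of_mem_span (a := ρ c) hx fun g => ?_).eq v
    change ρ c * ρ (ι g) = ρ (ι g) * ρ c
    rw [← map_mul, ← map_mul, hC c c.2]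
  have hcommPow : ∀ (c : C) (k : ℕ) (v : V), ρ c ((e ^ k) v) = (e ^ k) (ρ c v) := by
    intro c k
    induction k with
    | zero => simp
    | succ k ih =>
      intro v
      rw [pow_succ', Module.End.mul_apply, hcomm c e h.e_mem, ih, Module.End.mul_apply]
  have hstab : ∀ (c : C), ∀ w ∈ W, ρ c w ∈ W := fun c w hw =>
    ⟨by rw [← hcomm c f h.f_mem, hw.1, map_zero], by rw [← hcomm c (P _) (h.P_mem _), hw.2]⟩
  let act : C → W →ₗ[ℂ] W := fun c => (ρ c).restrict (hstab c)
  have hact_mul : ∀ (c c' : C) w, act (c * c') w = act c (act c' w) := fun c c' w =>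
    Subtype.ext (by change ρ (c * c' : G) (w : V) = ρ c (ρ c' w); rw [map_mul]; rfl)
  have hact_one : ∀ w, act 1 w = w := fun w => Subtype.ext (by
    change ρ (1 : G) (w : V) = w
    rw [map_one]; rfl)
  have hact_neg : ∀ w, act ⟨ι (-1), hneg⟩ w = (-1 : ℂ) • w := fun w => Subtype.ext (by
    change (ρ.comp ι) (-1) (w : V) = (-1 : ℂ) • (w : V)
    rw [← torus_neg_one, h.torus_apply w.2.2]
    congr 1
    simp [hj.neg_one_pow])
  let Inv : ℕ → Prop := fun k => ∃ ψ ∈ linearFunctions W ^ k,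
    (∀ (c : C) (w : W), ψ (act c w) = ψ w) ∧ ψ ≠ 0
  have hex : ∃ k, 0 < k ∧ Inv k := by
    let w₁ : W := ⟨w₀, hw₀⟩
    obtain ⟨l, hl, -⟩ := Submodule.exists_le_ker_of_notMem (K := ℂ) (p := (⊥ : Submodule ℂ W))
      (v := w₁) (by simpa [w₁, Subtype.ext_iff] using hw₀')
    -- The product of the translates of a nonzero functional l is invariant. It is not the zero
    -- function, since finitely many proper hyperplanes do not cover W.
    obtain ⟨w, -, hw⟩ := Module.Dual.exists_forall_mem_ne_zero_of_forall_exists (⊤ : Submodule ℂ W)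
      (fun c : C => l ∘ₗ act c) fun c => ⟨act c⁻¹ w₁, trivial, by
        rwa [LinearMap.comp_apply, ← hact_mul, mul_inv_cancel, hact_one]⟩
    refine ⟨Fintype.card C, Fintype.card_pos, ∏ c : C, fun w => (l ∘ₗ act c) w,
      prod_mem_pow _ _ fun c _ => ⟨_, rfl⟩, fun c w => ?_, fun h0 => ?_⟩
    · rw [Finset.prod_apply, Finset.prod_apply]
      simp only [LinearMap.comp_apply, ← hact_mul]
      exact Equiv.prod_comp (Equiv.mulRight c) fun c => l (act c w)
    · have := congrFun h0 w
      rw [Finset.prod_apply] at this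
      exact prod_ne_zero_iff.2 (fun c _ => hw c) this
  obtain ⟨d, ⟨hd0, ψ, hψ, hψC, hψ0⟩, hmin⟩ : ∃ d, (0 < d ∧ Inv d) ∧
      ∀ k, k < d → ¬ (0 < k ∧ Inv k) := ⟨Nat.find hex, Nat.find_spec hex, fun k => Nat.find_min hex⟩
  obtain ⟨w, hw⟩ : ∃ w, ψ w ≠ 0 := by
    by_contra! hc
    exact hψ0 (funext hc)
  -- The element -1 of C acts on W by -1, so ψ(w) = (-1)^d ψ(w) with ψ(w) ≠ 0.
  obtain ⟨m, rfl⟩ : ∃ m, d = 2 * m := by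
    have h1 := hψC ⟨ι (-1), hneg⟩ w
    rw [hact_neg, apply_smul_of_mem_pow hψ] at h1
    have h2 : (-1 : ℂ) ^ d = 1 := mul_right_cancel₀ hw (by rw [h1, one_mul])
    rcases Nat.even_or_odd d with h3 | h3
    · exact h3.exists_two_nsmul _ |>.imp fun m hm => by simpa using hm
    · rw [h3.neg_one_pow] at h2
      norm_num at h2
  have hm : 0 < m := by omega
  obtain ⟨F, hF, hFψ⟩ := h.exists_lift hψ
  let H : (Fin 2 → V) → ℂ := fun v => ∑ c : C, F fun i => ρ c (v i)
  have hH : H ∈ invariantPolynomials (copies ρ 2) := by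
    refine ⟨?_, fun g v => ?_⟩
    · have h1 : H = ∑ c : C, pullback ((ρ c).compLeft (Fin 2)) F := by
        funext v
        rw [Finset.sum_apply]
        rfl
      rw [h1]
      exact sum_mem fun c _ => pullback_mem_polyFunctions _ (polyFunctions_of_mem_pow hF)
    · obtain ⟨c, hc, x, rfl⟩ := hG g
      have h1 : ∀ c' : C, F (fun i => ρ c' ((copies ρ 2 (ι x * c) v) i)) =
          F fun i => ρ ((c' * ⟨c, hc⟩ : C) : G) (v i) := by
        intro c'
        rw [← h.invariant_of_mem_pow hF x fun i => ρ ((c' * ⟨c, hc⟩ : C) : G) (v i)]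
        congr 1
        funext i
        change ρ c' (ρ (ι x * c) (v i)) = ρ (ι x) (ρ (c' * c : G) (v i))
        rw [← Module.End.mul_apply, ← map_mul, ← Module.End.mul_apply, ← map_mul, ← mul_assoc,
          hC c' c'.2, mul_assoc]
      change ∑ c' : C, F (fun i => ρ c' ((copies ρ 2 (ι x * c) v) i)) = ∑ c' : C, F _
      simp_rw [h1]
      exact Equiv.sum_comp (Equiv.mulRight (⟨c, hc⟩ : C))
        fun c' : C => F fun i => ρ (c' : G) (v i)
  have hHhom : ∀ (t : Fin 2 → ℂ) (v : Fin 2 → V),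
      H (fun i => t i • v i) = (t 0 * t 1) ^ m * H v := by
    intro t v
    simp only [H, map_smul, mul_sum]
    exact sum_congr rfl fun c _ => bihomogeneous_of_mem_pow hF t fun i => ρ c (v i)
  have hHdiag : H (fun _ => (w : V) + (e ^ j) (w : V)) = 0 := by
    refine sum_eq_zero fun c _ => ?_
    simp only [map_add, hcommPow]
    exact h.diagonal_of_mem_pow hj hm hF (hstab c w w.2)
  have hHw : H ![(w : V), (e ^ j) (w : V)] ≠ 0 := by
    have h1 : H ![(w : V), (e ^ j) (w : V)] = ∑ c : C, ψ w := by
      refine sum_congr rfl fun c _ => ?_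
      rw [← hψC c w, ← hFψ]
      congr 1
      funext i
      fin_cases i
      · rfl
      · exact hcommPow c j w
    rw [h1, sum_const, nsmul_eq_mul]
    exact mul_ne_zero (by exact_mod_cast Fintype.card_ne_zero) hw
  intro hpol
  have hlow : ∀ F ∈ invariantPolynomials ρ, ∀ k, IsHomogeneousFunction F k → 0 < k → k < 2 * m →
      ∀ a b : ℂ, F (a • (w : V) + b • (e ^ j) (w : V)) = 0 := by
    intro F hF k hk hk0 hkm a b
    by_contra hne
    -- The map w ↦ a w + b e^j w is C-equivariant, so pulling F back would give a nonzero
    -- C-invariant of degree below the minimum.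
    refine hmin k hkm ⟨hk0, pullback (a • W.subtype + b • ((e ^ j) ∘ₗ W.subtype)) F,
      pullback_mem_pow _ (mem_pow_of_isHomogeneous hF.1 hk), fun c w => ?_,
      fun h0 => hne (congrFun h0 w)⟩
    have h1 := hF.2 c (a • (w : V) + b • (e ^ j) (w : V))
    rw [map_add, map_smul, map_smul, hcommPow] at h1
    exact h1
  have htorus : ∀ F ∈ invariantPolynomials ρ, IsHomogeneousFunction F (2 * m) →
      ∀ a b : ℂ, F (a • (w : V) + b • (e ^ j) (w : V)) =
        (a * b) ^ m * F ((w : V) + (e ^ j) (w : V)) := by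
    intro F hF hFm a b
    have hy : P j ((e ^ j) (w : V)) = (e ^ j) (w : V) := by
      have := h.weight_e_pow w.2.2 j
      rwa [show (-j + 2 * j : ℤ) = j by ring] at this
    have ht : ∀ (t : ℂˣ) (a b : ℂ), F (((t : ℂ) ^ (-j : ℤ) * a) • (w : V) +
        ((t : ℂ) ^ (j : ℤ) * b) • (e ^ j) (w : V)) = F (a • (w : V) + b • (e ^ j) (w : V)) := by
      intro t a b
      rw [← hF.2 (ι (torus t)) (a • (w : V) + b • (e ^ j) (w : V))]
      congr 1
      have h1 := h.torus_apply w.2.2 t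
      have h2 := h.torus_apply hy t
      simp only [MonoidHom.comp_apply] at h1 h2
      rw [map_add, map_smul, map_smul, h1, h2, smul_smul, smul_smul, mul_comm a, mul_comm b]
    have hone : ∀ z : ℂ, z ^ (2 * m) ≠ 1 → ∀ v, F (z • v) = F v → F v = 0 := by
      intro z hz v hv
      rw [hFm] at hv
      have : (z ^ (2 * m) - 1) * F v = 0 := by linear_combination hv
      exact (mul_eq_zero.1 this).resolve_left (sub_ne_zero.2 hz)
    -- If a or b is 0, the torus rescales the remaining vector by 2^j, which contradicts homogeneity
    -- unless F vanishes there.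
    have htwo : ((2 : ℂ) ^ (j : ℤ)) ^ (2 * m) ≠ 1 := by
      rw [zpow_natCast, ← pow_mul]
      intro h1
      have h2 : (2 : ℕ) ^ (j * (2 * m)) = 1 := by exact_mod_cast h1
      have := Nat.pow_eq_one.1 h2
      have := hj.pos
      rcases Nat.pow_eq_one.1 h2 with h3 | h3
      · omega
      · rcases Nat.mul_eq_zero.1 h3 with h4 | h4 <;> omega
    by_cases ha : a = 0
    · subst ha
      rw [zero_mul, zero_pow hm.ne', zero_mul]
      refine hone _ htwo _ ?_
      have := ht (Units.mk0 2 two_ne_zero) 0 b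
      simpa [smul_smul] using this
    by_cases hb : b = 0
    · subst hb
      rw [mul_zero, zero_pow hm.ne', zero_mul]
      refine hone _ htwo _ ?_
      have := ht (Units.mk0 2 two_ne_zero)⁻¹ a 0
      simpa [smul_smul] using this
    -- With c² = a b and t^j = c / b, the torus element t carries a w + b y to c (w + y), where F
    -- takes the value c^(2m) F(w + y).
    obtain ⟨c, hc⟩ := IsAlgClosed.exists_pow_nat_eq (a * b) (n := 2) two_pos
    have hc0 : c ≠ 0 := by
      rintro rfl
      exact mul_ne_zero ha hb (by rw [← hc]; simp)
    obtain ⟨t, htc⟩ := IsAlgClosed.exists_pow_nat_eq (c / b) (n := j) hj.pos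
    have ht0 : t ≠ 0 := by
      rintro rfl
      rw [zero_pow hj.pos.ne'] at htc
      exact div_ne_zero hc0 hb htc.symm
    have h1 := ht (Units.mk0 t ht0) a b
    rw [Units.val_mk0, zpow_neg, zpow_natCast, htc, inv_div, div_mul_cancel₀ _ hb,
      show b / c * a = c by field_simp; linear_combination -hc, ← smul_add, hFm] at h1
    rw [← h1, pow_mul, hc]
  have hle := polarizationAlgebra_le_compatibleFunctions hm hlow htorus
  rw [hpol] at hle
  obtain ⟨A, B, hA, hB, -, -, -, hAB⟩ := hle hH
  -- H vanishes on the diagonal line through w + y, while its restriction to the lines of w and y is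
  -- a nonzero monomial of exponent (m, m).
  have hB0 : B = 0 := MvPolynomial.funext fun t => by
    rw [hB, hHhom t fun _ => _, hHdiag, mul_zero, map_zero]
  have hA1 : A = MvPolynomial.monomial (diagExponent m) (H ![(w : V), (e ^ j) (w : V)]) :=
    MvPolynomial.funext fun t => by
      rw [hA, diagExponent, eval_monomial_fin, hHhom, Fin.prod_univ_two, mul_pow]
  rw [hB0, hA1, MvPolynomial.coeff_zero, MvPolynomial.coeff_monomial, if_pos rfl, eq_comm,
    mul_eq_zero] at hAB
  rcases hAB with h1 | h1
  · exact (Nat.multinomial_pos _ _).ne' (by exact_mod_cast h1)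
  · exact hHw h1

end SL2

/-! ### Reduction of the theorem to a lowest weight vector -/

theorem mainTheorem9 (n : ℕ) (G : Subgroup (GL (Fin n) ℂ)) (hG : IsLinearAlgebraicGroup G)
    (hG0 : AlgGroupIsomorphic (identityComponent G) algSL2)
    {V : Type*} [AddCommGroup V] [Module ℂ V] [FiniteDimensional ℂ V]
    (ρ : Representation ℂ G V) (hρ : IsRationalRep ρ)
    (j : ℕ) (hj : Odd j) (U : Subrepresentation (restrictIdentityComponent ρ))
    (hU : U.toRepresentation.IsIrreducible) (hdim : Module.finrank ℂ U.toSubmodule = j + 1) :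
    ¬ HasPolarizationProperty ρ 2 := by
  obtain ⟨ι, C, hfin, hneg, hC, hdec, hrange, hreg⟩ := SL2.exists_decomposition hG0
  have hR : SL2.IsPolynomialRep (ρ.comp ι) :=
    SL2.isPolynomialRep_of_coeff fun l v => hreg _ (hρ l v)
  obtain ⟨e, f, P, h⟩ := hR.exists_action
  have hmem : ∀ x, ((ι x : G) : GL (Fin n) ℂ) ∈ identityComponent G := fun x => by
    rw [← Subgroup.mem_subgroupOf, ← hrange]
    exact ⟨x, rfl⟩
  have hstab : ∀ x, ∀ v ∈ U.toSubmodule, (ρ.comp ι) x v ∈ U.toSubmodule := fun x v hv =>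
    U.apply_mem_toSubmodule ⟨ι x, hmem x⟩ hv
  have hirr : ∀ U' ≤ U.toSubmodule, (∀ x, ∀ v ∈ U', (ρ.comp ι) x v ∈ U') → U' ≠ ⊥ →
      U' = U.toSubmodule := by
    intro U' hle hU' hne
    -- Since ι has image G⁰, subspaces of U stable under SL₂ are subrepresentations for G⁰, and
    -- irreducibility carries over.
    let S : Subrepresentation U.toRepresentation :=
      { toSubmodule := U'.comap U.toSubmodule.subtype
        apply_mem_toSubmodule := fun g v hv => by
          obtain ⟨x, hx⟩ : (Subgroup.inclusion (identityComponent_le G) g) ∈ ι.range := by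
            rw [hrange, Subgroup.mem_subgroupOf]
            exact g.2
          have h1 := hU' x v hv
          rw [MonoidHom.comp_apply, hx] at h1
          exact h1 }
    rcases hU.eq_bot_or_eq_top S with hS | hS
    · refine absurd ?_ hne
      rw [eq_bot_iff]
      intro v hv
      have h1 : (⟨v, hle hv⟩ : U.toSubmodule) ∈ S.toSubmodule := hv
      rw [hS] at h1
      have h2 : (⟨v, hle hv⟩ : U.toSubmodule) = 0 := h1
      exact congrArg Subtype.val h2
    · refine le_antisymm hle fun v hv => ?_
      have h1 : (⟨v, hv⟩ : U.toSubmodule) ∈ S.toSubmodule := by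
        rw [hS]
        trivial
      exact h1
  obtain ⟨w, -, hw0, hfw, hPw, -⟩ := h.exists_lowest hstab hirr hdim
  exact SL2.not_hasPolarizationProperty ρ ι C hneg hC hdec h hj ⟨hfw, hPw⟩ hw0
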